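/- A cube complex is a space built from cubes $[0,1]^n$ (each embedded) glued along faces; nothing else is required of the intersection of two cubes. The link $\operatorname{lk}(\square,X)$ of a cube $\square$ of $X$ is the simplicial complex whose vertices are the cubes containing $\square$ as a codimension one face, where a finite nonempty collection of them spans a simplex iff they lie in a common cube. A simplicial complex is $5$-large if it is flag and no embedded cycle of length less than $5$ is a full subcomplex. A cube complex $X$ is $5$-large if the link of each vertex $v$ is a $5$-large simplicial complex (in particular, a cube containing $v$ is determined by its edges at $v$) and, for each vertex $v$, the cubical $2$-neighborhood of $v$ is contractible. Here distinct vertices are at cubical distance $1$ if they lie in a common cube, cubical distance is the path metric generated by this relation, and the cubical $2$-neighborhood of $v$ is the subcomplex of all cubes all of whose vertices are at cubical distance at most $2$ from $v$. Let $X$ be a finite $5$-large cube complex with vertex set $V(X)$, let $Y$ be a finite set and $\alpha : Y \to V(X)$ a surjection. The $\alpha$-thickening $\operatorname{Th}_\alpha(X)$ is the simplicial complex with vertex set $Y$ in which a finite nonempty subset of $Y$ spans a simplex iff its image under $\alpha$ is contained in a common cube of $X$. Let $\sigma$ be a nonempty simplex of $\operatorname{Th}_\alpha(X)$, with vertex set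 $V(\sigma)$. Then there is a smallest cube $\square_\sigma$ of $X$ containing $\alpha(V(\sigma))$ (it is contained in every other such cube), and the link $\operatorname{lk}(\sigma,\operatorname{Th}_\alpha(X))$ contains subcomplexes $\operatorname{lk}'$ and $\operatorname{lk}''$ such that 1. $\operatorname{lk}(\sigma,\operatorname{Th}_\alpha(X))$ is the join $\operatorname{lk}' * \operatorname{lk}''$; 2. $\operatorname{lk}'$ is either empty or a single simplex; in particular, if $\operatorname{lk}'$ is nonempty, then it is contractible; 3. $\operatorname{lk}''$ is homotopy equivalent to $\operatorname{lk}(\square_\sigma, X)$. The subcomplexes $\operatorname{lk}'$ and $\operatorname{lk}''$ may be empty. -/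

import Mathlib

open scoped ContinuousMap

universe u v

namespace PreAbstractSimplicialComplex

variable {ι : Type u}

/-- The geometric realization of an abstract simplicial complex `K`: the points are the families of
barycentric coordinates whose support is contained in a face of `K`. It carries the topology of
pointwise convergence of barycentric coordinates, which for a finite complex (the only case used
below) is the usual topology. -/
def Realization (K : PreAbstractSimplicialComplex ι) : Type u :=
  {x : ι → ℝ // (∀ i, 0 ≤ x i) ∧ ∃ s ∈ K.faces, (∀ i, i ∉ s → x i = 0) ∧ ∑ i ∈ s, x i = 1}

instance (K : PreAbstractSimplicialComplex ι) : TopologicalSpace K.Realization :=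
  inferInstanceAs (TopologicalSpace {x : ι → ℝ //
    (∀ i, 0 ≤ x i) ∧ ∃ s ∈ K.faces, (∀ i, i ∉ s → x i = 0) ∧ ∑ i ∈ s, x i = 1})

/-- The link of `σ` in `K`: the nonempty `τ` disjoint from `σ` such that `σ ∪ τ` is a face.
A vertex `y` of the link corresponds to the simplex `σ ∪ {y}`, of which `σ` is a codimension one
face. -/
def link [DecidableEq ι] (K : PreAbstractSimplicialComplex ι) (σ : Finset ι) :
    PreAbstractSimplicialComplex ι where
  faces := {τ | τ.Nonempty ∧ Disjoint σ τ ∧ σ ∪ τ ∈ K.faces}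
  isRelLowerSet_faces := by
    rintro τ ⟨hne, hd, hK⟩
    refine ⟨hne, fun t htτ htne => ⟨htne, hd.mono_right htτ, ?_⟩⟩
    exact (K.isRelLowerSet_faces hK).2 (Finset.union_subset_union_right htτ)
      (htne.mono Finset.subset_union_right)

/-- `K` is the join of its subcomplexes `L` and `M`: these have no vertex in common, and the faces
of `K` are the faces of `L`, the faces of `M`, and the unions of a face of `L` and a face of `M`. -/
def IsJoin [DecidableEq ι] (K L M : PreAbstractSimplicialComplex ι) : Prop :=
  (∀ s ∈ L.faces, ∀ t ∈ M.faces, Disjoint s t) ∧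
    ∀ r : Finset ι, r ∈ K.faces ↔
      r ∈ L.faces ∨ r ∈ M.faces ∨ ∃ s ∈ L.faces, ∃ t ∈ M.faces, r = s ∪ t

/-- `K` consists of a single simplex and its faces. -/
def IsSimplex (K : PreAbstractSimplicialComplex ι) : Prop :=
  ∃ s : Finset ι, s.Nonempty ∧ ∀ t : Finset ι, t ∈ K.faces ↔ t.Nonempty ∧ t ⊆ s

end PreAbstractSimplicialComplex

namespace AbstractSimplicialComplex

variable {ι : Type u}

/-- Two distinct vertices are adjacent if they lie in a common face. -/
def Adj (K : AbstractSimplicialComplex ι) (a b : ι) : Prop :=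
  a ≠ b ∧ ∃ s ∈ K.faces, a ∈ s ∧ b ∈ s

/-- A simplicial complex is flag if every nonempty finite set of pairwise adjacent vertices spans a
simplex. -/
def IsFlag (K : AbstractSimplicialComplex ι) : Prop :=
  ∀ s : Finset ι, s.Nonempty → (∀ a ∈ s, ∀ b ∈ s, a ≠ b → K.Adj a b) → s ∈ K.faces

/-- A simplicial complex is `k`-large if it is flag and no embedded cycle of length `n < k` is a
full subcomplex: some face has all its vertices on the cycle without being a face of the cycle. -/
def IsLarge (K : AbstractSimplicialComplex ι) (k : ℕ) : Prop :=
  K.IsFlag ∧ ∀ n : ℕ, 3 ≤ n → n < k → ∀ f : ZMod n → ι, Function.Injective f →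
    (∀ i, K.Adj (f i) (f (i + 1))) →
    ∃ s ∈ K.faces, (∀ a ∈ s, ∃ i, a = f i) ∧ ¬ ∃ i, ∀ a ∈ s, a = f i ∨ a = f (i + 1)

end AbstractSimplicialComplex

/-- The order complex of a partially ordered set: its simplices are the nonempty finite chains. -/
def orderComplex (P : Type u) [PartialOrder P] : AbstractSimplicialComplex P where
  faces := {s | s.Nonempty ∧ IsChain (· ≤ ·) (s : Set P)}
  isRelLowerSet_faces := by
    rintro s ⟨hne, hs⟩
    exact ⟨hne, fun t hts htne => ⟨htne, hs.mono (Finset.coe_subset.mpr hts)⟩⟩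
  singleton_mem := fun v => ⟨Finset.singleton_nonempty v, by simp⟩

/-- A cube complex, given by its cubes (of all dimensions) ordered by inclusion: the faces of each
cube form a copy of the poset of nonempty faces of some `[0,1]^n`. These faces are the intervals
`[a, b]` of the Boolean lattice `{0,1}^n`, ordered by inclusion. Nothing is required of the
intersection of two cubes: it may consist of several faces, and different cubes may have the same
vertices or even the same boundary. -/
class CubeComplex (X : Type u) extends PartialOrder X where
  exists_iso : ∀ c : X, ∃ n : ℕ, Nonempty (Set.Iic c ≃o NonemptyInterval (Fin n → Bool))

namespace CubeComplex

variable (X : Type u) [CubeComplex X]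

/-- The vertices of a cube complex are its minimal cubes. -/
def Vertex : Type u := {v : X // IsMin v}

variable {X}

/-- The combinatorial link of the cube `q`. Its vertices are the cubes that contain `q` as a
codimension one face; a collection of them spans a simplex iff they lie in a common cube. -/
def link (q : X) : AbstractSimplicialComplex {c : X // q ⋖ c} where
  faces := {s | s.Nonempty ∧ ∃ d : X, ∀ c ∈ s, c.1 ≤ d}
  isRelLowerSet_faces := by
    rintro s ⟨hne, d, hd⟩
    exact ⟨hne, fun t hts htne => ⟨htne, d, fun c hc => hd c (hts hc)⟩⟩
  singleton_mem := fun v => ⟨Finset.singleton_nonempty v, v.1, by simp⟩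

variable (X)

/-- A cube complex is locally `k`-large if the link of each vertex `v` is a `k`-large simplicial
complex. The first clause says that the link is a simplicial complex at all: its cells, which are
the corners at `v` of the cubes containing `v`, are determined by their vertices, which are the
edges at `v`. -/
def IsLocallyLarge (k : ℕ) : Prop :=
  ∀ v : X, IsMin v →
    (∀ c d : X, v ≤ c → v ≤ d → (∀ e : X, v ⋖ e → (e ≤ c ↔ e ≤ d)) → c = d) ∧
    (link v).IsLarge k

/-- Two distinct vertices are at cubical distance one if they lie in a common cube. -/
def cubicalGraph : SimpleGraph (Vertex X) where
  Adj v w := v ≠ w ∧ ∃ c : X, v.1 ≤ c ∧ w.1 ≤ c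
  symm := ⟨fun _ _ h => ⟨h.1.symm, h.2.imp fun _ hc => hc.symm⟩⟩
  loopless := ⟨fun _ h => h.1 rfl⟩

variable {X}

/-- The cubical `k`-neighborhood of the vertex `v`: the subcomplex spanned by the vertices at
cubical distance at most `k` from `v`, that is, all cubes all of whose vertices are such. -/
def cubicalNeighborhood (k : ℕ) (v : Vertex X) : Set X :=
  {c | ∀ w : Vertex X, w.1 ≤ c → (cubicalGraph X).edist v w ≤ k}

variable (X)

/-- A cube complex is `5`-large if it is locally `5`-large and the cubical `2`-neighborhood of every
vertex is contractible. A subcomplex is realized through its barycentric subdivision, which is the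
order complex of its set of cubes. -/
def IsFiveLarge : Prop :=
  IsLocallyLarge X 5 ∧ ∀ v : Vertex X, ContractibleSpace
    (orderComplex (cubicalNeighborhood 2 v)).toPreAbstractSimplicialComplex.Realization

variable {X}

/-- The `α`-thickening: the simplicial complex with vertex set `Y` in which a nonempty finite set
spans a simplex iff its image under `α` is contained in a common cube. -/
def thickening {Y : Type v} (α : Y → Vertex X) : AbstractSimplicialComplex Y where
  faces := {s | s.Nonempty ∧ ∃ c : X, ∀ y ∈ s, (α y).1 ≤ c}
  isRelLowerSet_faces := by
    rintro s ⟨hne, d, hd⟩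
    exact ⟨hne, fun t hts htne => ⟨htne, d, fun c hc => hd c (hts hc)⟩⟩
  singleton_mem := fun y => ⟨Finset.singleton_nonempty y, (α y).1, by simp⟩

end CubeComplex

/-! The heart of the matter is `edge_le_of_vertices_le`: if cubes `c` and `d` share vertices `v` and
`w`, then `d` contains the edges of `c` at `v` in the directions in which `v` and `w` differ. Then
the face of `c` spanned by such edges lies in every cube containing the given vertices, which yields
the smallest cube.

To prove it, consider words of oriented edges up to pushing across squares. Flagness of the links
completes three squares around a vertex to a cube; this makes the swap relation transitive, and
every edge then acts on the classes of reduced words by a permutation, its holonomy, which is flat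
on squares. A contractible subcomplex has no nontrivial coverings, so on the `2`-neighborhood of
`v`, which contains both cubes, the holonomy is a coboundary. Hence a path in `c` and a path in `d`,
both from `w` to `v`, have equal holonomy. Both are reduced, so they differ by swaps
(`swap_of_hol_eq`). Swaps of a word of edges of `d` never leave `d`, so the edges of the first path
lie in `d`.

For the link, let `q` be the smallest cube of `σ`. Every simplex containing `σ` lies in a cube above
`q`, so the link is the join of its vertices over `q`, which span a simplex, and an outer part. An
outer `y` is sent to a cover of `q` inside the smallest cube containing `σ` and `y`; a cover of `q`
is sent to some `y` over one of its vertices outside `q`. For each cube above `q` these maps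
exchange a face of the outer part and a face of the link of `q`, so both composites are homotopic to
the identity along straight lines. -/

/-- A system of oriented edges with inverses and squares: `Sq a b a' b'` says that the paths
`a, b` and `a', b'` are the two ways around a square. The field `cube` completes three squares
around a common vertex to a cube. -/
structure SquareSystem (D : Type u) where
  inv : D → D
  inv_inv : ∀ a, inv (inv a) = a
  Sq : D → D → D → D → Prop
  symm : ∀ {a b a' b'}, Sq a b a' b' → Sq a' b' a b
  rot : ∀ {a b a' b'}, Sq a b a' b' → Sq (inv a) a' b (inv b')
  uniq : ∀ {a b a' b' c c'}, Sq a b a' b' → Sq a c a' c' → b = c ∧ b' = c'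
  ne : ∀ {a b a' b'}, Sq a b a' b' → b ≠ b'
  ne_inv : ∀ {a b a' b'}, Sq a b a' b' → b ≠ inv a
  cube : ∀ {a b c a' b' a'' b'' c' c''}, Sq b' a a' b → Sq c' b b'' c → Sq c'' a' a'' c' →
    ∃ w a₃ c₃, Sq c'' b' w c₃ ∧ Sq a'' b'' w a₃ ∧ Sq c₃ a a₃ c

namespace SquareSystem

variable {D : Type u} (Q : SquareSystem D)

theorem opp {a b a' b' : D} (h : Q.Sq a b a' b') :
    Q.Sq (Q.inv b) (Q.inv a) (Q.inv b') (Q.inv a') :=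
  Q.rot (Q.symm (Q.rot h))

theorem uniq_right {a b a' b' c c' : D} (h : Q.Sq a b a' b') (h' : Q.Sq a b c' c) :
    a' = c' ∧ b' = c := by
  obtain ⟨h1, h2⟩ := Q.uniq (Q.rot h) (Q.rot h')
  exact ⟨h1, by simpa [Q.inv_inv] using congrArg Q.inv h2⟩

theorem uniq_left {a b a' b' c c' : D} (h : Q.Sq a b a' b') (h' : Q.Sq c b c' b') :
    a = c ∧ a' = c' := by
  obtain ⟨h1, h2⟩ := Q.uniq (Q.opp h) (Q.opp h')
  exact ⟨by simpa [Q.inv_inv] using congrArg Q.inv h1,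
    by simpa [Q.inv_inv] using congrArg Q.inv h2⟩

/-! ### Words up to swaps -/

/-- Words of edges up to pushing them across squares. A word is written backwards: its head is its
last letter. -/
inductive Swap : List D → List D → Prop
  | nil : Swap [] []
  | cons {a p q} : Swap p q → Swap (a :: p) (a :: q)
  | sq {a b a' b' p q r} : Q.Sq b' a a' b → Swap p (b' :: r) → Swap q (a' :: r) →
      Swap (a :: p) (b :: q)

namespace Swap

variable {Q}

theorem refl : ∀ p : List D, Q.Swap p p
  | [] => nil
  | _ :: p => cons (refl p)

theorem symm {p q : List D} (h : Q.Swap p q) : Q.Swap q p := by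
  induction h with
  | nil => exact nil
  | cons _ ih => exact cons ih
  | sq h h1 h2 _ _ => exact sq (Q.symm h) h2 h1

theorem length_eq {p q : List D} (h : Q.Swap p q) : p.length = q.length := by
  induction h with
  | nil => rfl
  | cons _ ih => simp [ih]
  | sq h h1 h2 ih1 ih2 => simp_all

theorem swap {a b a' b' : D} (h : Q.Sq b' a a' b) (r : List D) :
    Q.Swap (a :: b' :: r) (b :: a' :: r) :=
  sq h (refl _) (refl _)

/-- The induction is on length because transitivity is applied to tails that are not subterms of the
given derivations. When both steps push across squares, the tail of the middle word may itself need
a square; the three squares then surround a vertex and `cube` supplies the opposite half of the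
cube. -/
theorem trans_aux (n : ℕ) : ∀ {p q s : List D}, q.length = n → Q.Swap p q → Q.Swap q s →
    Q.Swap p s := by
  induction n with
  | zero =>
    intro p q s hn h1 h2
    obtain rfl := List.length_eq_zero_iff.1 hn
    cases h1
    exact h2
  | succ n ih =>
    intro p q s hn h1 h2
    cases h1 with
    | nil => simp at hn
    | @cons a p q h1 =>
      have hn : q.length = n := by simpa using hn
      cases h2 with
      | cons h2 => exact cons (ih hn h1 h2)
      | sq h h2 h3 => exact sq h (ih hn h1 h2) h3
    | @sq a b a' b' p q r h h1 h2 =>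
      have hn : q.length = n := by simpa using hn
      cases h2 with
      | cons h3 => exact sq h h1 (ih hn h3.symm h2)
      | @sq _ c b'' c' _ s t h' h3 h4 =>
        have h5 := ih hn h2.symm h3
        have hr : (b' :: r).length = n := by
          have := h2.length_eq
          simp only [List.length_cons] at this ⊢
          omega
        have ht : (b'' :: t).length = n := by
          have := h3.length_eq
          simp only [List.length_cons] at this ⊢
          omega
        cases h5 with
        | cons h5 =>
          -- Here the two squares share the consecutive sides `a'` and `b`, so they coincide.
          obtain ⟨e1, e2⟩ := Q.uniq_right (Q.symm h) h'
          subst e1 e2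
          exact cons (ih hr h1 (ih ht (cons h5) h4.symm))
        | @sq _ _ a'' c'' _ _ u k h5 h6 =>
          obtain ⟨w, a₃, c₃, k1, k2, k3⟩ := Q.cube h h' k
          exact sq k3 (ih hr h1 (sq k1 h5 (refl _))) (ih ht h4 (sq k2 h6 (refl _)))

theorem trans {p q s : List D} (h1 : Q.Swap p q) (h2 : Q.Swap q s) : Q.Swap p s :=
  trans_aux _ rfl h1 h2

theorem of_cons {a : D} {p q : List D} (h : Q.Swap (a :: p) (a :: q)) : Q.Swap p q := by
  cases h with
  | cons h => exact h
  | sq h _ _ => exact absurd rfl (Q.ne h)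

theorem exists_sq {a b : D} {p q : List D} (h : Q.Swap (a :: p) (b :: q)) (hab : a ≠ b) :
    ∃ a' b' r, Q.Sq b' a a' b ∧ Q.Swap p (b' :: r) ∧ Q.Swap q (a' :: r) := by
  cases h with
  | cons h => exact absurd rfl hab
  | sq h h1 h2 => exact ⟨_, _, _, h, h1, h2⟩

/-- A set of letters that contains with two consecutive sides of a square also the other two sides
is preserved by swaps. -/
theorem forall_mem {C : D → Prop} (hC : ∀ {a b a' b'}, Q.Sq a b a' b' → C a → C b → C a' ∧ C b')
    {p q : List D} (h : Q.Swap p q) (hp : ∀ x ∈ p, C x) : ∀ x ∈ q, C x := by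
  -- An equivalence is needed for the induction, since a square uses the hypothesis on `q`
  -- backwards.
  have key : ∀ {p q : List D}, Q.Swap p q → ((∀ x ∈ p, C x) ↔ ∀ x ∈ q, C x) := by
    intro p q h
    induction h with
    | nil => simp
    | cons _ ih => simp [ih]
    | sq h h1 h2 ih1 ih2 =>
      simp only [List.forall_mem_cons] at ih1 ih2 ⊢
      rw [ih1, ih2]
      exact ⟨fun k => have := hC h k.2.1 k.1; ⟨this.2, this.1, k.2.2⟩,
        fun k => have := hC (Q.symm h) k.2.1 k.1; ⟨this.2, this.1, k.2.2⟩⟩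
  exact (key h).1 hp

end Swap

/-! ### Reduced words and their holonomy -/

/-- A word is reduced if no backtracking can be produced in it by swaps. -/
def Reduced : List D → Prop
  | [] => True
  | a :: p => Reduced p ∧ ∀ q, ¬ Q.Swap p (Q.inv a :: q)

variable {Q}

/-- A backtracking produced after a push across a square can be carried back through that square,
where it contradicts reducedness of the original word or of its tail. -/
theorem Reduced.congr_aux (n : ℕ) : ∀ {p q : List D}, p.length = n → Q.Swap p q → Q.Reduced p →
    Q.Reduced q := by
  induction n with
  | zero =>
    intro p q hn h _
    obtain rfl := List.length_eq_zero_iff.1 (h.length_eq ▸ hn)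
    trivial
  | succ n ih =>
    intro p q hn h hp
    cases h with
    | nil => trivial
    | cons h => exact ⟨ih (by simpa using hn) h hp.1, fun t ht => hp.2 t (h.trans ht)⟩
    | @sq a b a' b' p q r h h1 h2 =>
      have hn : p.length = n := by simpa using hn
      have hr := ih hn h1 hp.1
      have hq : Q.Reduced q := by
        refine ih (p := a' :: r) ?_ h2.symm ⟨hr.1, fun t ht => hp.2 (b :: t) ?_⟩
        · rw [← hn, h1.length_eq]; rfl
        · exact h1.trans (.sq (Q.rot (Q.symm h)) ht (Swap.refl _))
      refine ⟨hq, fun t ht => ?_⟩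
      obtain ⟨x, y, u, k, k1, k2⟩ := (h2.symm.trans ht).exists_sq
        (fun e => Q.ne_inv (Q.symm h) (by rw [e, Q.inv_inv]))
      have k3 : Q.Sq (Q.inv b') a' a (Q.inv b) := Q.rot h
      obtain ⟨rfl, -⟩ := Q.uniq_left k k3
      exact hr.2 _ k1

theorem Reduced.congr {p q : List D} (h : Q.Swap p q) (hp : Q.Reduced p) : Q.Reduced q :=
  Reduced.congr_aux _ rfl h hp

/-- `p` followed by the edge `a` is homotopic to `q`. -/
def Step (Q : SquareSystem D) (a : D) (p q : List D) : Prop :=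
  Q.Swap p (Q.inv a :: q) ∨ Q.Swap q (a :: p)

theorem Step.inv {a : D} {p q : List D} (h : Q.Step a p q) : Q.Step (Q.inv a) q p := by
  rw [Step, Q.inv_inv]
  exact h.symm

/-- The edge cancels against the end of `p` if some swap allows it, and is appended otherwise. -/
theorem Step.exists (a : D) {p : List D} (hp : Q.Reduced p) : ∃ q, Q.Reduced q ∧ Q.Step a p q := by
  by_cases h : ∃ q, Q.Swap p (Q.inv a :: q)
  · obtain ⟨q, hq⟩ := h
    exact ⟨q, (hp.congr hq).1, .inl hq⟩
  · exact ⟨a :: p, ⟨hp, fun q hq => h ⟨q, hq⟩⟩, .inr (Swap.refl _)⟩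

theorem Step.unique {a : D} {p p' q q' : List D} (hq : Q.Reduced q) (hq' : Q.Reduced q')
    (hp : Q.Swap p p') (h : Q.Step a p q) (h' : Q.Step a p' q') : Q.Swap q q' := by
  rcases h with h | h <;> rcases h' with h' | h'
  · exact ((h.symm.trans hp).trans h').of_cons
  · exact absurd (hp.symm.trans h) ((hq'.congr h').2 _)
  · exact absurd (hp.trans h') ((hq.congr h).2 _)
  · exact h.trans ((Swap.cons hp).trans h'.symm)

/-- This is the flatness of the action. Each side of the square either cancels or is appended; in
the mixed cases a further square, identified by `uniq_left`, shows what the other way around does.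
-/
theorem Step.square {a b a' b' : D} (hs : Q.Sq a b a' b') {p q r : List D} (hp : Q.Reduced p)
    (hr : Q.Reduced r) (h : Q.Step a p q) (h' : Q.Step b q r) :
    ∃ s, Q.Reduced s ∧ Q.Step a' p s ∧ Q.Step b' s r := by
  rcases h with h | h <;> rcases h' with h' | h'
  · have h1 : Q.Swap p (Q.inv a' :: Q.inv b' :: r) :=
      h.trans ((Swap.cons h').trans (Swap.swap (Q.opp hs) r))
    exact ⟨_, (hp.congr h1).1, .inl h1, .inl (Swap.refl _)⟩
  · obtain ⟨s, hs', h1⟩ := Step.exists a' hp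
    refine ⟨s, hs', h1, ?_⟩
    rcases h1 with h1 | h1
    · obtain ⟨x, y, u, k, k1, k2⟩ := (h.symm.trans h1).exists_sq
        (fun e => Q.ne (Q.opp hs) e)
      obtain ⟨rfl, -⟩ := Q.uniq_left k (Q.opp hs)
      exact absurd k1 ((hr.congr h').2 _)
    · refine .inl (h1.trans ((Swap.cons h).trans ?_))
      exact (Swap.swap (Q.rot hs) q).trans (Swap.cons h'.symm)
  · obtain ⟨x, y, u, k, k1, k2⟩ := (h.symm.trans h').exists_sq
        (fun e => Q.ne_inv hs (by rw [e, Q.inv_inv]))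
    obtain ⟨rfl, rfl⟩ := Q.uniq_left k (Q.rot (Q.symm hs))
    exact ⟨u, (hp.congr k1).1, .inl k1, .inr k2⟩
  · have h1 : Q.Swap r (b' :: a' :: p) := h'.trans ((Swap.cons h).trans (Swap.swap hs p))
    exact ⟨_, (hr.congr h1).1, .inr (Swap.refl _), .inr h1⟩

variable (Q)

/-- The setoid of swaps on the reduced words. -/
def swapSetoid : Setoid {p : List D // Q.Reduced p} where
  r p q := Q.Swap p.1 q.1
  iseqv := ⟨fun _ => Swap.refl _, Swap.symm, Swap.trans⟩

/-- Reduced words up to swaps. -/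
def Classes : Type u := Quotient Q.swapSetoid

/-- The class of a reduced word. -/
def cls (p : List D) (hp : Q.Reduced p) : Q.Classes := Quotient.mk Q.swapSetoid ⟨p, hp⟩

variable {Q}

theorem cls_eq {p q : List D} {hp : Q.Reduced p} {hq : Q.Reduced q} :
    Q.cls p hp = Q.cls q hq ↔ Q.Swap p q :=
  ⟨fun h => Quotient.exact (s := Q.swapSetoid) h, fun h => Quotient.sound (s := Q.swapSetoid) (a := ⟨p, hp⟩) (b := ⟨q, hq⟩) h⟩

theorem cls_surj (m : Q.Classes) : ∃ p hp, Q.cls p hp = m := by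
  induction m using Quotient.inductionOn with
  | h p => exact ⟨p.1, p.2, rfl⟩

variable (Q)

theorem exists_act (a : D) : ∃ f : Q.Classes → Q.Classes, ∀ p hp q hq,
    f (Q.cls p hp) = Q.cls q hq ↔ Q.Step a p q := by
  have h (m : Q.Classes) : ∃ (p q : List D) (hp : Q.Reduced p), Q.Reduced q ∧
      Q.cls p hp = m ∧ Q.Step a p q := by
    obtain ⟨p, hp, rfl⟩ := cls_surj m
    obtain ⟨q, hq, h⟩ := Step.exists a hp
    exact ⟨p, q, hp, hq, rfl, h⟩
  choose p q hp hq h1 h2 using h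
  refine ⟨fun m => Q.cls (q m) (hq m), fun p' hp' q' hq' => ?_⟩
  have h3 := cls_eq.1 (h1 (Q.cls p' hp'))
  rw [cls_eq]
  refine ⟨fun h => ?_, fun h => Step.unique (hq _) hq' h3 (h2 _) h⟩
  rcases h2 (Q.cls p' hp') with k | k
  · exact .inl (h3.symm.trans (k.trans (Swap.cons h)))
  · exact .inr (h.symm.trans (k.trans (Swap.cons h3)))

/-- The action of an edge on the classes of reduced words. -/
noncomputable def act (a : D) : Q.Classes → Q.Classes := (Q.exists_act a).choose

variable {Q}

theorem act_cls {a : D} {p q : List D} {hp : Q.Reduced p} {hq : Q.Reduced q} :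
    Q.act a (Q.cls p hp) = Q.cls q hq ↔ Q.Step a p q :=
  (Q.exists_act a).choose_spec p hp q hq

theorem act_inv_act (a : D) (m : Q.Classes) : Q.act (Q.inv a) (Q.act a m) = m := by
  obtain ⟨p, hp, rfl⟩ := cls_surj m
  obtain ⟨q, hq, h⟩ := cls_surj (Q.act a (Q.cls p hp))
  rw [← h, act_cls]
  exact (act_cls.1 h.symm).inv

theorem act_square {a b a' b' : D} (hs : Q.Sq a b a' b') (m : Q.Classes) :
    Q.act b (Q.act a m) = Q.act b' (Q.act a' m) := by
  obtain ⟨p, hp, rfl⟩ := cls_surj m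
  obtain ⟨q, hq, h⟩ := cls_surj (Q.act a (Q.cls p hp))
  obtain ⟨r, hr, h'⟩ := cls_surj (Q.act b (Q.cls q hq))
  obtain ⟨s, hs', h1, h2⟩ := Step.square hs hp hr (act_cls.1 h.symm) (act_cls.1 h'.symm)
  rw [← h, ← h', (act_cls (hq := hs')).2 h1, (act_cls (hq := hr)).2 h2]

variable (Q)

/-- The holonomy of an edge. -/
noncomputable def hol (a : D) : Equiv.Perm Q.Classes where
  toFun := Q.act a
  invFun := Q.act (Q.inv a)
  left_inv := act_inv_act a
  right_inv m := by simpa [Q.inv_inv] using act_inv_act (Q.inv a) m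

theorem hol_inv (a : D) : Q.hol (Q.inv a) = (Q.hol a)⁻¹ := by
  ext m
  rfl

variable {Q}

theorem hol_square {a b a' b' : D} (hs : Q.Sq a b a' b') :
    Q.hol b * Q.hol a = Q.hol b' * Q.hol a' := by
  ext m
  exact act_square hs m

/-- Letters of a reduced word never cancel, so its holonomy applied to the empty word rebuilds the
word. Thus the holonomy remembers the class. -/
theorem hol_word : ∀ {p : List D} (hp : Q.Reduced p),
    (p.map Q.hol).prod (Q.cls [] trivial) = Q.cls p hp
  | [], _ => rfl
  | a :: p, hp => by
    rw [List.map_cons, List.prod_cons, Equiv.Perm.mul_apply, hol_word hp.1]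
    exact act_cls.2 (.inr (Swap.refl _))

/-- Reduced words with the same holonomy differ by swaps. -/
theorem swap_of_hol_eq {p q : List D} (hp : Q.Reduced p) (hq : Q.Reduced q)
    (h : (p.map Q.hol).prod = (q.map Q.hol).prod) : Q.Swap p q := by
  rw [← cls_eq (hp := hp) (hq := hq), ← hol_word hp, ← hol_word hq, h]

end SquareSystem

/-! ### Cocycles on contractible complexes -/

namespace PreAbstractSimplicialComplex

variable {ι : Type u} (K : PreAbstractSimplicialComplex ι)

namespace Realization

variable {K}

theorem continuous_apply (i : ι) : Continuous fun x : K.Realization => x.1 i :=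
  (_root_.continuous_apply i).comp continuous_subtype_val

theorem continuous_mk {A : Type*} [TopologicalSpace A] {f : A → K.Realization}
    (h : ∀ i, Continuous fun a => (f a).1 i) : Continuous f :=
  Continuous.subtype_mk (continuous_pi h) fun a => (f a).2

theorem exists_pos (x : K.Realization) : ∃ i, 0 < x.1 i := by
  obtain ⟨h0, s, hs, h1, h2⟩ := x.2
  by_contra! h
  rw [Finset.sum_eq_zero fun i _ => le_antisymm (h i) (h0 i)] at h2
  exact zero_ne_one h2

theorem exists_face (x : K.Realization) : ∃ s ∈ K.faces, ∀ i, 0 < x.1 i → i ∈ s := by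
  obtain ⟨h0, s, hs, h1, h2⟩ := x.2
  exact ⟨s, hs, fun i hi => by_contra fun h => hi.ne' (h1 i h)⟩

/-- The point of the edge from `i` to `j` with parameter `t`. -/
noncomputable def edgePoint [DecidableEq ι] {s : Finset ι} (hs : s ∈ K.faces) {i j : ι}
    (hi : i ∈ s) (hj : j ∈ s) (t : unitInterval) : K.Realization :=
  ⟨fun l => (if l = i then 1 - (t : ℝ) else 0) + if l = j then (t : ℝ) else 0, fun l => by
      have h0 := t.2.1
      have h1 := t.2.2
      beta_reduce
      split_ifs <;> linarith,
    s, hs, fun l hl => by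
      have h1 : l ≠ i := fun h => hl (h ▸ hi)
      have h2 : l ≠ j := fun h => hl (h ▸ hj)
      simp [h1, h2], by
      simp [Finset.sum_add_distrib, hi, hj]⟩

theorem continuous_edgePoint [DecidableEq ι] {s : Finset ι} (hs : s ∈ K.faces) {i j : ι}
    (hi : i ∈ s) (hj : j ∈ s) : Continuous (edgePoint hs hi hj) := by
  refine continuous_mk fun l => ?_
  simp only [edgePoint]
  split_ifs <;> fun_prop

theorem edgePoint_pos [DecidableEq ι] {s : Finset ι} (hs : s ∈ K.faces) {i j : ι}
    (hi : i ∈ s) (hj : j ∈ s) {t : unitInterval} (ht : (t : ℝ) < 1) :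
    0 < (edgePoint hs hi hj t).1 i := by
  have h0 := t.2.1
  simp only [edgePoint, if_true]
  split_ifs <;> linarith

end Realization

open Realization

variable {K} {G : Type v} [Group G]

/-- The covering space associated with a `G`-valued cocycle on the edges of a complex, glued from
the trivial coverings of the open stars. -/
noncomputable def cocycleBundle [TopologicalSpace G] [DiscreteTopology G] (g : ι → ι → G)
    (hg : ∀ i j k, (∃ s ∈ K.faces, i ∈ s ∧ j ∈ s ∧ k ∈ s) → g i j * g j k = g i k) :
    FiberBundleCore ι K.Realization G where
  baseSet i := {x | 0 < x.1 i}
  isOpen_baseSet i := isOpen_lt continuous_const (continuous_apply i)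
  indexAt x := (exists_pos x).choose
  mem_baseSet_at x := (exists_pos x).choose_spec
  coordChange i j _ v := v * g i j
  coordChange_self i x hx v := by
    obtain ⟨s, hs, h⟩ := exists_face x
    simpa using hg i i i ⟨s, hs, h i hx, h i hx, h i hx⟩
  continuousOn_coordChange i j :=
    ((continuous_of_discreteTopology (f := fun v : G => v * g i j)).comp
      continuous_snd).continuousOn
  coordChange_comp i j k x hx v := by
    obtain ⟨s, hs, h⟩ := exists_face x
    rw [mul_assoc, hg i j k ⟨s, hs, h i hx.1.1, h j hx.1.2, h k hx.2⟩]

/-- On a contractible complex, every cocycle is a coboundary. -/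
theorem exists_coboundary [ContractibleSpace K.Realization] (g : ι → ι → G)
    (hg : ∀ i j k, (∃ s ∈ K.faces, i ∈ s ∧ j ∈ s ∧ k ∈ s) → g i j * g j k = g i k) :
    ∃ k : ι → G, ∀ i j, (∃ s ∈ K.faces, i ∈ s ∧ j ∈ s) → g i j = (k i)⁻¹ * k j := by
  classical
  let _ : TopologicalSpace G := ⊥
  have : DiscreteTopology G := ⟨rfl⟩
  let Z := cocycleBundle g hg
  have cov : IsCoveringMap Z.proj := FiberBundle.isCoveringMap (F := G) (E := Z.Fiber)
  obtain ⟨x₀, ⟨H⟩⟩ := id_nullhomotopic K.Realization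
  let e₀ : Z.TotalSpace := ⟨x₀, (1 : G)⟩
  -- The reversed contraction runs from a constant map to the identity, so its lift at time `1` is a
  -- global section of the covering.
  let S := cov.liftHomotopy H.symm.toContinuousMap (ContinuousMap.const _ e₀) (fun a => by
    simp [e₀, FiberBundleCore.proj])
  have hS (x : K.Realization) : (S (1, x)).1 = x := by
    have := congrFun (cov.liftHomotopy_lifts H.symm.toContinuousMap (ContinuousMap.const _ e₀)
      (fun a => by simp [e₀, FiberBundleCore.proj])) (1, x)
    simpa using this
  have hSc : Continuous fun x => S (1, x) := by fun_prop
  -- The section read in the trivialization over the open star of `i`; it is locally constant there.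
  let w (i : ι) (x : K.Realization) : G := (Z.localTriv i (S (1, x))).2
  have hw (i : ι) : ContinuousOn (w i) (Z.baseSet i) := by
    refine continuous_snd.comp_continuousOn
      ((Z.localTriv i).continuousOn.comp hSc.continuousOn fun x hx => ?_)
    rw [FiberBundleCore.mem_localTriv_source, hS]
    exact hx
  have hwg (i j : ι) (x : K.Realization) (hi : x ∈ Z.baseSet i) (hj : x ∈ Z.baseSet j) :
      w j x = w i x * g i j := by
    have := Z.coordChange_comp (Z.indexAt x) i j x ⟨⟨Z.mem_baseSet_at x, hi⟩, hj⟩ (S (1, x)).2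
    simp only [w, FiberBundleCore.localTriv_apply, hS]
    exact this.symm
  have hconst {s : Finset ι} (hs : s ∈ K.faces) {i j : ι} (hi : i ∈ s) (hj : j ∈ s)
      (t : unitInterval) (ht : (t : ℝ) < 1) :
      w i (edgePoint hs hi hj t) = w i (edgePoint hs hi hj 0) := by
    have hpos (r : unitInterval) : edgePoint hs hi hj (r * t) ∈ Z.baseSet i := by
      refine edgePoint_pos hs hi hj ?_
      exact (mul_le_of_le_one_left t.2.1 r.2.2).trans_lt ht
    have hc : Continuous fun r : unitInterval => w i (edgePoint hs hi hj (r * t)) :=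
      (hw i).comp_continuous ((continuous_edgePoint hs hi hj).comp (by fun_prop)) hpos
    simpa using PreconnectedSpace.constant inferInstance hc (x := 1) (y := 0)
  -- The coboundary is the value of the section at the vertex `i`; indices that are not vertices get
  -- the irrelevant value `1`.
  refine ⟨fun i => if h : ∃ s ∈ K.faces, i ∈ s then
    w i (edgePoint h.choose_spec.1 h.choose_spec.2 h.choose_spec.2 0) else 1, ?_⟩
  rintro i j ⟨s, hs, hi, hj⟩
  have h1 : ∃ s ∈ K.faces, i ∈ s := ⟨s, hs, hi⟩
  have h2 : ∃ s ∈ K.faces, j ∈ s := ⟨s, hs, hj⟩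
  have e1 : edgePoint h1.choose_spec.1 h1.choose_spec.2 h1.choose_spec.2 0 =
      edgePoint hs hi hj 0 := Subtype.ext (by simp [edgePoint])
  have e2 : edgePoint h2.choose_spec.1 h2.choose_spec.2 h2.choose_spec.2 0 =
      edgePoint hs hj hi 0 := Subtype.ext (by simp [edgePoint])
  -- The midpoint of the edge lies in both open stars, so the two local values can be compared
  -- there.
  let m : unitInterval := ⟨1 / 2, by norm_num, by norm_num⟩
  have e3 : edgePoint hs hj hi m = edgePoint hs hi hj m :=
    Subtype.ext <| funext fun l => by
      simp only [edgePoint, m]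
      split_ifs <;> norm_num
  have hm : (m : ℝ) < 1 := by norm_num [m]
  have key := hwg i j (edgePoint hs hi hj m) (edgePoint_pos hs hi hj hm)
    (e3 ▸ edgePoint_pos hs hj hi hm)
  rw [hconst hs hi hj m hm, ← e3, hconst hs hj hi m hm] at key
  beta_reduce
  rw [dif_pos h1, dif_pos h2, e1, e2, key, inv_mul_cancel_left]

end PreAbstractSimplicialComplex

/-! ### Coordinates on cubes -/

namespace CubeComplex

variable {X : Type u} [CubeComplex X]

/-- Coordinates on the cube `d`: the face `F p s` is the face of `d` that contains the vertex with
coordinates `p` and has the set of directions `s`. -/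
structure Chart (d : X) where
  dim : ℕ
  F : (Fin dim → Bool) → Finset (Fin dim) → X
  le_iff : ∀ {p s r t}, F p s ≤ F r t ↔ s ⊆ t ∧ ∀ i, i ∉ t → p i = r i
  le : ∀ p s, F p s ≤ d
  exists_eq : ∀ {x}, x ≤ d → ∃ p s, x = F p s

theorem exists_chart (d : X) : Nonempty (Chart d) := by
  obtain ⟨n, ⟨φ⟩⟩ := exists_iso d
  let I (p : Fin n → Bool) (s : Finset (Fin n)) : NonemptyInterval (Fin n → Bool) :=
    ⟨(fun i => if i ∈ s then false else p i, fun i => if i ∈ s then true else p i), fun i => by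
      by_cases h : i ∈ s <;> simp [h]⟩
  have hI (p s r t) : I p s ≤ I r t ↔ s ⊆ t ∧ ∀ i, i ∉ t → p i = r i := by
    rw [NonemptyInterval.le_def]
    simp only [I, Pi.le_def, ← forall_and, Finset.subset_iff]
    refine forall_congr' fun i => ?_
    by_cases hs : i ∈ s <;> by_cases ht : i ∈ t <;> cases p i <;> cases r i <;> simp [hs, ht]
  have hsurj (J : NonemptyInterval (Fin n → Bool)) : ∃ p s, J = I p s := by
    refine ⟨J.fst, Finset.univ.filter fun i => J.fst i ≠ J.snd i, ?_⟩
    refine NonemptyInterval.ext (Prod.ext ?_ ?_) <;> funext i <;>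
      have := J.fst_le_snd i <;> revert this <;> simp only [I, Finset.mem_filter,
        Finset.mem_univ, true_and] <;> cases h1 : J.fst i <;> cases h2 : J.snd i <;> simp
  refine ⟨⟨n, fun p s => (φ.symm (I p s)).1, ?_, fun p s => (φ.symm (I p s)).2, ?_⟩⟩
  · intro p s r t
    rw [← hI, Subtype.coe_le_coe, φ.symm.le_iff_le]
  · intro x hx
    obtain ⟨p, s, h⟩ := hsurj (φ ⟨x, hx⟩)
    exact ⟨p, s, by rw [← h, OrderIso.symm_apply_apply]⟩

/-- Change the coordinate `i` of `p`. -/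
def flip {n : ℕ} (p : Fin n → Bool) (i : Fin n) : Fin n → Bool := Function.update p i (!p i)

theorem flip_self {n : ℕ} (p : Fin n → Bool) (i : Fin n) : flip p i i = !p i := by
  simp [flip]

theorem flip_of_ne {n : ℕ} (p : Fin n → Bool) {i j : Fin n} (h : j ≠ i) : flip p i j = p j := by
  simp [flip, h]

theorem flip_flip {n : ℕ} (p : Fin n → Bool) (i : Fin n) : flip (flip p i) i = p := by
  simp [flip]

theorem flip_ne {n : ℕ} (p : Fin n → Bool) (i : Fin n) : flip p i ≠ p := fun h => by
  simpa [flip_self] using congrFun h i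

theorem flip_comm {n : ℕ} (p : Fin n → Bool) (i j : Fin n) :
    flip (flip p i) j = flip (flip p j) i := by
  rcases eq_or_ne i j with rfl | h
  · rfl
  · simp only [flip]
    rw [Function.update_comm h, Function.update_of_ne h.symm, Function.update_of_ne h]

theorem flip_injective {n : ℕ} (p : Fin n → Bool) : Function.Injective (flip p) := by
  intro i j h
  by_contra hij
  have := congrFun h i
  rw [flip_self, flip_of_ne _ hij] at this
  simp at this

/-- Two paths of length two with the same ends and different midpoints, not returning to the start,
change the same two coordinates in opposite orders. -/
theorem eq_of_flip_flip_eq {n : ℕ} {p : Fin n → Bool} {i j k l : Fin n}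
    (h : flip (flip p i) k = flip (flip p j) l) (hij : i ≠ j) (hp : flip (flip p i) k ≠ p) :
    k = j ∧ l = i := by
  have hk : k = j := by
    by_contra hk
    have h1 := congrFun h j
    rw [flip_of_ne _ (Ne.symm hk), flip_of_ne _ hij.symm] at h1
    by_cases hl : l = j
    · subst hl
      exact hp (h.trans (flip_flip p l))
    · rw [flip_of_ne _ (Ne.symm hl), flip_self] at h1
      simp at h1
  subst hk
  rw [flip_comm] at h
  exact ⟨rfl, (flip_injective _ h).symm⟩

namespace Chart

variable {d : X} (C : Chart d)

theorem eq_iff {p r : Fin C.dim → Bool} {s t : Finset (Fin C.dim)} :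
    C.F p s = C.F r t ↔ s = t ∧ ∀ i, i ∉ s → p i = r i := by
  rw [le_antisymm_iff, C.le_iff, C.le_iff]
  constructor
  · rintro ⟨⟨h1, h2⟩, h3, h4⟩
    obtain rfl := h1.antisymm h3
    exact ⟨rfl, h2⟩
  · rintro ⟨rfl, h⟩
    exact ⟨⟨subset_rfl, h⟩, subset_rfl, fun i hi => (h i hi).symm⟩

/-- The vertex with coordinates `p`. -/
def vert (p : Fin C.dim → Bool) : X := C.F p ∅

theorem vert_injective : Function.Injective C.vert := fun _ _ h =>
  funext fun i => (C.eq_iff.1 h).2 i (Finset.notMem_empty i)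

theorem isMin_vert (p : Fin C.dim → Bool) : IsMin (C.vert p) := by
  intro x hx
  obtain ⟨r, t, rfl⟩ := C.exists_eq (hx.trans (C.le _ _))
  obtain ⟨h1, h2⟩ := C.le_iff.1 hx
  exact C.le_iff.2 ⟨Finset.empty_subset _, fun i _ => (h2 i (Finset.notMem_empty i)).symm⟩

theorem exists_vert_eq {x : X} (hx : IsMin x) (h : x ≤ d) : ∃ p, x = C.vert p := by
  obtain ⟨p, s, rfl⟩ := C.exists_eq h
  exact ⟨p, le_antisymm (hx (C.le_iff.2 ⟨Finset.empty_subset _, fun _ _ => rfl⟩))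
    (C.le_iff.2 ⟨Finset.empty_subset _, fun _ _ => rfl⟩)⟩

theorem vert_le_iff {p r : Fin C.dim → Bool} {t : Finset (Fin C.dim)} :
    C.vert p ≤ C.F r t ↔ ∀ i, i ∉ t → p i = r i := by
  simp [vert, C.le_iff]

theorem vert_le (p : Fin C.dim → Bool) (s : Finset (Fin C.dim)) : C.vert p ≤ C.F p s :=
  C.vert_le_iff.2 fun _ _ => rfl

theorem F_le_iff {p : Fin C.dim → Bool} {s t : Finset (Fin C.dim)} :
    C.F p s ≤ C.F p t ↔ s ⊆ t := by
  simp [C.le_iff]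

theorem exists_of_vert_le {p : Fin C.dim → Bool} {x : X} (h : C.vert p ≤ x) (hx : x ≤ d) :
    ∃ s, x = C.F p s := by
  obtain ⟨r, t, rfl⟩ := C.exists_eq hx
  exact ⟨t, C.eq_iff.2 ⟨rfl, fun i hi => (C.vert_le_iff.1 h i hi).symm⟩⟩

theorem vert_covBy (p : Fin C.dim → Bool) (i : Fin C.dim) : C.vert p ⋖ C.F p {i} := by
  refine ⟨lt_of_le_not_ge (C.vert_le _ _) fun h => ?_, fun x hx hx' => ?_⟩
  · simpa using (C.le_iff.1 h).1
  · obtain ⟨s, rfl⟩ := C.exists_of_vert_le hx.le (hx'.le.trans (C.le _ _))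
    rcases Finset.subset_singleton_iff.1 (C.F_le_iff.1 hx'.le) with rfl | rfl
    · exact hx.ne rfl
    · exact hx'.ne rfl

theorem exists_of_covBy {p : Fin C.dim → Bool} {x : X} (h : C.vert p ⋖ x) (hx : x ≤ d) :
    ∃ i, x = C.F p {i} := by
  obtain ⟨s, rfl⟩ := C.exists_of_vert_le h.le hx
  obtain rfl | ⟨i, hi⟩ := s.eq_empty_or_nonempty
  · exact absurd rfl h.lt.ne
  · refine ⟨i, ((h.eq_or_eq (C.vert_le p {i}) (C.F_le_iff.2 (by simpa using hi))).resolve_left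
      fun e => ?_).symm⟩
    exact (C.vert_covBy p i).lt.ne e.symm

theorem covBy_le_iff {p : Fin C.dim → Bool} {s : Finset (Fin C.dim)} {x : X}
    (h : C.vert p ⋖ x) : x ≤ C.F p s ↔ ∃ i ∈ s, x = C.F p {i} := by
  constructor
  · intro hx
    obtain ⟨i, rfl⟩ := C.exists_of_covBy h (hx.trans (C.le _ _))
    exact ⟨i, by simpa using C.F_le_iff.1 hx, rfl⟩
  · rintro ⟨i, hi, rfl⟩
    exact C.F_le_iff.2 (by simpa using hi)

end Chart

/-! ### Oriented edges and squares of a cube complex -/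

variable (X) in
/-- Oriented edges. -/
@[ext]
structure Dart where
  src : X
  tgt : X
  edge : X
  isMin_src : IsMin src
  isMin_tgt : IsMin tgt
  ne : src ≠ tgt
  src_covBy : src ⋖ edge
  tgt_covBy : tgt ⋖ edge

namespace Dart

/-- The reversed edge. -/
def inv (a : Dart X) : Dart X := ⟨a.tgt, a.src, a.edge, a.isMin_tgt, a.isMin_src, a.ne.symm,
  a.tgt_covBy, a.src_covBy⟩

/-- The paths `a, b` and `a', b'` are the two ways around a square. -/
def Sq (a b a' b' : Dart X) : Prop :=
  (a.src = a'.src ∧ a.tgt = b.src ∧ a'.tgt = b'.src ∧ b.tgt = b'.tgt) ∧ a.src ≠ b.tgt ∧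
    a.tgt ≠ a'.tgt ∧ ∃ d, a.edge ≤ d ∧ b.edge ≤ d ∧ a'.edge ≤ d ∧ b'.edge ≤ d

variable {a b a' b' : Dart X}

theorem Sq.symm (h : Sq a b a' b') : Sq a' b' a b := by
  obtain ⟨⟨h1, h2, h3, h4⟩, h5, h6, d, k1, k2, k3, k4⟩ := h
  exact ⟨⟨h1.symm, h3, h2, h4.symm⟩, by rwa [← h1, ← h4], h6.symm, d, k3, k4, k1, k2⟩

theorem Sq.rot (h : Sq a b a' b') : Sq a.inv a' b b'.inv := by
  obtain ⟨⟨h1, h2, h3, h4⟩, h5, h6, d, k1, k2, k3, k4⟩ := h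
  exact ⟨⟨h2, h1, h4, h3⟩, h6, h5, d, k1, k3, k2, k4⟩

theorem Sq.opp (h : Sq a b a' b') : Sq b.inv a.inv b'.inv a'.inv := h.rot.symm.rot

end Dart

namespace Chart

variable {d : X} (C : Chart d)

/-- The edge starting from the vertex `p` in the direction `i`. -/
def dart (p : Fin C.dim → Bool) (i : Fin C.dim) : Dart X where
  src := C.vert p
  tgt := C.vert (flip p i)
  edge := C.F p {i}
  isMin_src := C.isMin_vert _
  isMin_tgt := C.isMin_vert _
  ne h := flip_ne p i (C.vert_injective h).symm
  src_covBy := C.vert_covBy p i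
  tgt_covBy := by
    have : C.F p {i} = C.F (flip p i) {i} :=
      C.eq_iff.2 ⟨rfl, fun j hj => (flip_of_ne p (by simpa using hj)).symm⟩
    rw [this]
    exact C.vert_covBy _ i

theorem exists_dart_eq {a : Dart X} (h : a.edge ≤ d) : ∃ p i, a = C.dart p i := by
  obtain ⟨p, hp⟩ := C.exists_vert_eq a.isMin_src (a.src_covBy.le.trans h)
  obtain ⟨r, hr⟩ := C.exists_vert_eq a.isMin_tgt (a.tgt_covBy.le.trans h)
  obtain ⟨i, hi⟩ := C.exists_of_covBy (hp ▸ a.src_covBy) h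
  refine ⟨p, i, Dart.ext hp ?_ hi⟩
  have h1 := a.tgt_covBy.le
  rw [hr, hi, C.vert_le_iff] at h1
  have hne : r ≠ p := fun e => a.ne (by rw [hp, hr, e])
  have h2 : r i ≠ p i := fun e => hne <| funext fun j => by
    by_cases hj : j = i
    · rw [hj, e]
    · exact h1 j (by simpa using hj)
  rw [hr]
  refine congrArg C.vert (funext fun j => ?_)
  by_cases hj : j = i
  · rw [hj, flip_self]
    revert h2
    cases r i <;> cases p i <;> simp
  · rw [flip_of_ne _ hj, h1 j (by simpa using hj)]

theorem dart_inj {p r : Fin C.dim → Bool} {i j : Fin C.dim} (h : C.dart p i = C.dart r j) :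
    p = r ∧ i = j :=
  ⟨C.vert_injective (congrArg Dart.src h),
    by simpa using (C.eq_iff.1 (congrArg Dart.edge h)).1⟩

theorem dart_inv (p : Fin C.dim → Bool) (i : Fin C.dim) :
    (C.dart p i).inv = C.dart (flip p i) i := by
  refine Dart.ext rfl ?_ ?_
  · simp [Dart.inv, dart, flip_flip]
  · exact C.eq_iff.2 ⟨rfl, fun j hj => (flip_of_ne p (by simpa using hj)).symm⟩

theorem dart_sq (p : Fin C.dim → Bool) {i j : Fin C.dim} (h : i ≠ j) :
    Dart.Sq (C.dart p i) (C.dart (flip p i) j) (C.dart p j) (C.dart (flip p j) i) := by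
  refine ⟨⟨rfl, rfl, rfl, congrArg C.vert (flip_comm p i j)⟩, fun e => ?_, fun e => ?_, d,
    C.le _ _, C.le _ _, C.le _ _, C.le _ _⟩
  · have := congrFun (C.vert_injective e) i
    rw [flip_of_ne _ h, flip_self] at this
    simp at this
  · exact h (flip_injective p (C.vert_injective e))

theorem exists_of_sq {a b a' b' : Dart X} (h : Dart.Sq a b a' b') (ha : a.edge ≤ d)
    (hb : b.edge ≤ d) (ha' : a'.edge ≤ d) (hb' : b'.edge ≤ d) :
    ∃ p i j, i ≠ j ∧ a = C.dart p i ∧ b = C.dart (flip p i) j ∧ a' = C.dart p j ∧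
      b' = C.dart (flip p j) i := by
  obtain ⟨⟨h1, h2, h3, h4⟩, h5, h6, -⟩ := h
  obtain ⟨p, i, rfl⟩ := C.exists_dart_eq ha
  obtain ⟨p', j, rfl⟩ := C.exists_dart_eq ha'
  obtain ⟨r, k, rfl⟩ := C.exists_dart_eq hb
  obtain ⟨r', l, rfl⟩ := C.exists_dart_eq hb'
  obtain rfl := C.vert_injective h1
  obtain rfl := C.vert_injective h2
  obtain rfl := C.vert_injective h3
  have hij : i ≠ j := fun e => h6 (by rw [e])
  obtain ⟨rfl, rfl⟩ := eq_of_flip_flip_eq (C.vert_injective h4) hij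
    (fun e => h5 (congrArg C.vert e.symm))
  exact ⟨p, l, k, hij, rfl, rfl, rfl, rfl⟩

end Chart

/-- The two squares have the same edges at the source of `a`. Cells of a vertex link are determined
by their vertices, so both squares are the same cube and can be compared in one chart. -/
theorem Dart.Sq.uniq {k : ℕ} (hX : IsLocallyLarge X k) {a b a' b' c c' : Dart X}
    (h : Sq a b a' b') (h' : Sq a c a' c') : b = c ∧ b' = c' := by
  obtain ⟨d, h1, h2, h3, h4⟩ := h.2.2.2
  obtain ⟨d', k1, k2, k3, k4⟩ := h'.2.2.2
  obtain ⟨C⟩ := exists_chart d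
  obtain ⟨C'⟩ := exists_chart d'
  obtain ⟨p, i, j, hij, ha, hb, ha', hb'⟩ := C.exists_of_sq h h1 h2 h3 h4
  obtain ⟨r, l, m, hlm, ka, kb, ka', kb'⟩ := C'.exists_of_sq h' k1 k2 k3 k4
  have hp : a.src = C.vert p := congrArg Dart.src ha
  have hr : a.src = C'.vert r := congrArg Dart.src ka
  have hq : C.F p {i, j} = C'.F r {l, m} := by
    refine (hX a.src a.isMin_src).1 _ _ (hp ▸ C.vert_le _ _) (hr ▸ C'.vert_le _ _) fun e he => ?_
    rw [C.covBy_le_iff (hp ▸ he), C'.covBy_le_iff (hr ▸ he)]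
    have e1 : C.F p {i} = C'.F r {l} := congrArg Dart.edge (ha.symm.trans ka)
    have e2 : C.F p {j} = C'.F r {m} := congrArg Dart.edge (ha'.symm.trans ka')
    simp [e1, e2]
  have hc : c.edge ≤ C.F p {i, j} := by
    rw [hq, kb]
    refine C'.le_iff.2 ⟨by simp, fun x hx => flip_of_ne _ fun e => hx (by simp [e])⟩
  have hc' : c'.edge ≤ C.F p {i, j} := by
    rw [hq, kb']
    refine C'.le_iff.2 ⟨by simp, fun x hx => flip_of_ne _ fun e => hx (by simp [e])⟩
  obtain ⟨p', i', j', -, la, lb, la', lb'⟩ :=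
    C.exists_of_sq h' h1 (hc.trans (C.le _ _)) h3 (hc'.trans (C.le _ _))
  obtain ⟨rfl, rfl⟩ := C.dart_inj (ha.symm.trans la)
  obtain ⟨-, rfl⟩ := C.dart_inj (ha'.symm.trans la')
  exact ⟨hb.trans lb.symm, hb'.trans lb'.symm⟩

/-- A cube containing two adjacent sides of a square contains the square. -/
theorem Dart.Sq.le_of_le {k : ℕ} (hX : IsLocallyLarge X k) {a b a' b' : Dart X}
    (h : Sq a b a' b') {d : X} (ha : a.edge ≤ d) (ha' : a'.edge ≤ d) :
    b.edge ≤ d ∧ b'.edge ≤ d := by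
  obtain ⟨C⟩ := exists_chart d
  obtain ⟨p, i, rfl⟩ := C.exists_dart_eq ha
  obtain ⟨r, j, rfl⟩ := C.exists_dart_eq ha'
  obtain rfl := C.vert_injective h.1.1
  have hij : i ≠ j := fun e => h.2.2.1 (by rw [e])
  obtain ⟨rfl, rfl⟩ := h.uniq hX (C.dart_sq p hij)
  exact ⟨C.le _ _, C.le _ _⟩

/-- Flagness of the link of `v` for three vertices, some of which may coincide. -/
theorem exists_common_cube {k : ℕ} (hX : IsLocallyLarge X k) {v : X} (hv : IsMin v) {x y z : X}
    (hx : v ⋖ x) (hy : v ⋖ y) (hz : v ⋖ z) (hxy : ∃ d, x ≤ d ∧ y ≤ d) (hyz : ∃ d, y ≤ d ∧ z ≤ d)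
    (hxz : ∃ d, x ≤ d ∧ z ≤ d) : ∃ d, x ≤ d ∧ y ≤ d ∧ z ≤ d := by
  classical
  have hadj {x y : X} (hx : v ⋖ x) (hy : v ⋖ y) (h : ∃ d, x ≤ d ∧ y ≤ d)
      (hne : (⟨x, hx⟩ : {c : X // v ⋖ c}) ≠ ⟨y, hy⟩) : (link v).Adj ⟨x, hx⟩ ⟨y, hy⟩ := by
    obtain ⟨d, h1, h2⟩ := h
    exact ⟨hne, {⟨x, hx⟩, ⟨y, hy⟩}, ⟨by simp, d, by simp [h1, h2]⟩, by simp, by simp⟩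
  have hsymm {x y : X} (h : ∃ d, x ≤ d ∧ y ≤ d) : ∃ d, y ≤ d ∧ x ≤ d :=
    h.imp fun _ h => h.symm
  obtain ⟨-, d, hd⟩ := (hX v hv).2.1 {⟨x, hx⟩, ⟨y, hy⟩, ⟨z, hz⟩} (by simp) (by
    simp only [Finset.mem_insert, Finset.mem_singleton]
    rintro _ (rfl | rfl | rfl) _ (rfl | rfl | rfl) hne
    · exact absurd rfl hne
    · exact hadj _ _ hxy hne
    · exact hadj _ _ hxz hne
    · exact hadj _ _ (hsymm hxy) hne
    · exact absurd rfl hne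
    · exact hadj _ _ hyz hne
    · exact hadj _ _ (hsymm hxz) hne
    · exact hadj _ _ (hsymm hyz) hne
    · exact absurd rfl hne)
  exact ⟨d, hd ⟨x, hx⟩ (by simp), hd ⟨y, hy⟩ (by simp), hd ⟨z, hz⟩ (by simp)⟩

/-- The three squares meet at the source of `b`. Their edges there lie pairwise in a common cube,
hence all in one cube `d`, and a chart of `d` displays the three missing squares. -/
theorem Dart.Sq.cube {k : ℕ} (hX : IsLocallyLarge X k) {a b c a' b' a'' b'' c' c'' : Dart X}
    (h₁ : Sq b' a a' b) (h₂ : Sq c' b b'' c) (h₃ : Sq c'' a' a'' c') :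
    ∃ w a₃ c₃, Sq c'' b' w c₃ ∧ Sq a'' b'' w a₃ ∧ Sq c₃ a a₃ c := by
  have k₁ := h₁.symm.rot
  have k₂ := h₂.rot
  have k₃ := h₃.opp
  have e₁ : a'.tgt = b.src := h₁.1.2.2.1
  have e₂ : c'.tgt = b.src := h₂.1.2.1
  obtain ⟨d, d1, d2, d3⟩ := exists_common_cube hX b.isMin_src b.src_covBy (e₁ ▸ a'.tgt_covBy)
    (e₂ ▸ c'.tgt_covBy) (h₁.2.2.2.imp fun _ h => ⟨h.2.2.2, h.2.2.1⟩)
    (h₃.2.2.2.imp fun _ h => ⟨h.2.1, h.2.2.2⟩) (h₂.2.2.2.imp fun _ h => ⟨h.2.1, h.1⟩)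
  obtain ⟨C⟩ := exists_chart d
  have l₁ := k₁.le_of_le hX d2 d1
  have l₂ := k₂.le_of_le hX d3 d1
  have l₃ := k₃.le_of_le hX d2 d3
  obtain ⟨z, i, j, hij, m1, m2, m3, m4⟩ := C.exists_of_sq k₁ d2 l₁.1 d1 l₁.2
  obtain ⟨z', k', j', hkj, n1, n2, n3, n4⟩ := C.exists_of_sq k₂ d3 l₂.1 d1 l₂.2
  obtain ⟨z'', i', k'', hik, o1, o2, o3, o4⟩ := C.exists_of_sq k₃ d2 l₃.1 d3 l₃.2
  obtain ⟨rfl, rfl⟩ := C.dart_inj (m3.symm.trans n3)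
  obtain ⟨rfl, rfl⟩ := C.dart_inj (m1.symm.trans o1)
  obtain ⟨-, rfl⟩ := C.dart_inj (n1.symm.trans o3)
  have f1 : a = (C.dart (flip z j) i).inv := congrArg Dart.inv m4
  have f2 : c = (C.dart (flip z j) k').inv := congrArg Dart.inv n4
  have f3 : c'' = (C.dart (flip z i) k').inv := congrArg Dart.inv o2
  have f4 : a'' = (C.dart (flip z k') i).inv := congrArg Dart.inv o4
  refine ⟨C.dart (flip (flip z i) k') j, (C.dart (flip (flip z k') j) i).inv,
    (C.dart (flip (flip z i) j) k').inv, ?_, ?_, ?_⟩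
  · rw [f3, m2]
    exact (C.dart_sq (flip z i) hkj).rot
  · rw [f4, n2, flip_comm z i k']
    exact (C.dart_sq (flip z k') hij).rot
  · rw [f1, f2, flip_comm z i j, flip_comm z k' j]
    exact (C.dart_sq (flip z j) hik).opp

/-- The oriented edges of a locally large cube complex. -/
def squareSystem {k : ℕ} (hX : IsLocallyLarge X k) : SquareSystem (Dart X) where
  inv := Dart.inv
  inv_inv _ := rfl
  Sq := Dart.Sq
  symm := Dart.Sq.symm
  rot := Dart.Sq.rot
  uniq := Dart.Sq.uniq hX
  ne h e := h.2.2.1 (by rw [h.1.2.1, h.1.2.2.1, e])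
  ne_inv h e := h.2.1 (by rw [e]; rfl)
  cube := Dart.Sq.cube hX

end CubeComplex

/-! ### Potentials of flat assignments -/

namespace CubeComplex

/-- An assignment of group elements to the oriented edges of the cube `{0,1}^n` that is flat on
squares is the coboundary of a function on the vertices. -/
theorem exists_potential_cube {n : ℕ} {G : Type v} [Group G] (r : (Fin n → Bool) → Fin n → G)
    (hinv : ∀ p i, r (flip p i) i = (r p i)⁻¹)
    (hsq : ∀ p i j, i ≠ j → r (flip p i) j * r p i = r (flip p j) i * r p j) :
    ∃ h : (Fin n → Bool) → G, ∀ p i, h (flip p i) = r p i * h p := by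
  -- The directions are admitted one at a time.
  suffices H : ∀ U : Finset (Fin n), ∃ h : (Fin n → Bool) → G,
      ∀ p, ∀ i ∈ U, h (flip p i) = r p i * h p by
    obtain ⟨h, hh⟩ := H Finset.univ
    exact ⟨h, fun p i => hh p i (Finset.mem_univ i)⟩
  intro U
  induction U using Finset.induction_on with
  | empty => exact ⟨1, by simp⟩
  | insert k U hk ih =>
    obtain ⟨h, hh⟩ := ih
    -- The old potential is kept where coordinate `k` is false and transported along direction `k`
    -- to the opposite side; flatness preserves compatibility with the directions in `U`.
    refine ⟨fun p => if p k then r (flip p k) k * h (flip p k) else h p, fun p i hi => ?_⟩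
    beta_reduce
    rcases eq_or_ne i k with rfl | hik
    · rw [flip_self, flip_flip]
      cases p i <;> simp [hinv]
    · have hi : i ∈ U := (Finset.mem_insert.1 hi).resolve_left hik
      rw [flip_of_ne _ hik.symm]
      cases hp : p k
      · simp [hh p i hi]
      · have := hsq (flip p k) i k hik
        rw [flip_flip] at this
        simp only [if_true]
        rw [flip_comm p i k, hh _ _ hi, ← mul_assoc, this, mul_assoc]

variable {X : Type u} [CubeComplex X]

namespace Chart

variable {d : X} (C : Chart d)

/-- Change the coordinates in the list `l`. -/
def flips (p : Fin C.dim → Bool) : List (Fin C.dim) → Fin C.dim → Bool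
  | [] => p
  | i :: l => flip (flips p l) i

/-- The path, written backwards, that changes the coordinates in `l` one by one. -/
def word (p : Fin C.dim → Bool) : List (Fin C.dim) → List (Dart X)
  | [] => []
  | i :: l => C.dart (C.flips p l) i :: word p l

theorem flips_apply (p : Fin C.dim → Bool) {l : List (Fin C.dim)} (hl : l.Nodup)
    (i : Fin C.dim) : C.flips p l i = if i ∈ l then !p i else p i := by
  induction l with
  | nil => simp [flips]
  | cons j l ih =>
    have ih := ih (List.nodup_cons.1 hl).2
    rcases eq_or_ne i j with rfl | hij
    · have := (List.nodup_cons.1 hl).1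
      simp [flips, flip_self, ih, this]
    · simp [flips, flip_of_ne _ hij, ih, hij]

theorem exists_flips_eq (p r : Fin C.dim → Bool) :
    ∃ l : List (Fin C.dim), l.Nodup ∧ (∀ i, i ∈ l ↔ p i ≠ r i) ∧ C.flips p l = r := by
  refine ⟨(Finset.univ.filter fun i => p i ≠ r i).toList, Finset.nodup_toList _, by simp, ?_⟩
  funext i
  rw [flips_apply _ _ (Finset.nodup_toList _)]
  cases h1 : p i <;> cases h2 : r i <;> simp [h1, h2]

theorem word_edge_le (p : Fin C.dim → Bool) (l : List (Fin C.dim)) :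
    ∀ a ∈ C.word p l, a.edge ≤ d := by
  induction l with
  | nil => simp [word]
  | cons i l ih => simpa [word] using ⟨C.le _ _, ih⟩

theorem eq_of_dart_eq (C : Chart d) {T : Type*} {f : X → T} (hf : ∀ a : Dart X, a.edge ≤ d → f a.src = f a.tgt)
    {x y : X} (hx : IsMin x) (hy : IsMin y) (hxd : x ≤ d) (hyd : y ≤ d) : f x = f y := by
  obtain ⟨p, rfl⟩ := C.exists_vert_eq hx hxd
  obtain ⟨r, rfl⟩ := C.exists_vert_eq hy hyd
  obtain ⟨l, -, -, rfl⟩ := C.exists_flips_eq p r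
  clear hyd hy
  induction l with
  | nil => rfl
  | cons i l ih => exact ih.trans (hf (C.dart (C.flips p l) i) (C.le _ _))

theorem potential_word {G : Type v} [Group G] {ρ : Dart X → G} {f : X → G}
    (hf : ∀ a : Dart X, a.edge ≤ d → f a.tgt = ρ a * f a.src) (p : Fin C.dim → Bool)
    (l : List (Fin C.dim)) :
    f (C.vert (C.flips p l)) = ((C.word p l).map ρ).prod * f (C.vert p) := by
  induction l with
  | nil => simp [flips, word]
  | cons i l ih =>
    rw [word, List.map_cons, List.prod_cons, mul_assoc, ← ih]
    exact hf (C.dart (C.flips p l) i) (C.le _ _)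

theorem exists_potential (C : Chart d) {G : Type v} [Group G] {ρ : Dart X → G}
    (hinv : ∀ a, ρ a.inv = (ρ a)⁻¹)
    (hsq : ∀ a b a' b', Dart.Sq a b a' b' → ρ b * ρ a = ρ b' * ρ a') :
    ∃ f : X → G, ∀ a : Dart X, a.edge ≤ d → f a.tgt = ρ a * f a.src := by
  obtain ⟨h, hh⟩ := exists_potential_cube (fun p i => ρ (C.dart p i))
    (fun p i => by rw [← C.dart_inv, hinv]) (fun p i j hij => hsq _ _ _ _ (C.dart_sq p hij))
  refine ⟨Function.extend C.vert h 1, fun a ha => ?_⟩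
  obtain ⟨p, i, rfl⟩ := C.exists_dart_eq ha
  have e (p) : Function.extend C.vert h 1 (C.vert p) = h p :=
    C.vert_injective.extend_apply h 1 p
  exact (e _).trans ((hh p i).trans (congrArg _ (e p).symm))

end Chart

theorem exists_vertex_le (c : X) : ∃ z, IsMin z ∧ z ≤ c := by
  obtain ⟨C⟩ := exists_chart c
  exact ⟨C.vert fun _ => false, C.isMin_vert _, C.le _ _⟩

/-- A flat assignment of group elements to the oriented edges of a contractible subcomplex is the
coboundary of a function on the vertices. -/
theorem exists_potential {B : Set X} (hB : IsLowerSet B)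
    [ContractibleSpace (orderComplex B).toPreAbstractSimplicialComplex.Realization]
    {G : Type v} [Group G] {ρ : Dart X → G} (hinv : ∀ a, ρ a.inv = (ρ a)⁻¹)
    (hsq : ∀ a b a' b', Dart.Sq a b a' b' → ρ b * ρ a = ρ b' * ρ a') :
    ∃ f : X → G, ∀ a : Dart X, a.edge ∈ B → f a.tgt = ρ a * f a.src := by
  classical
  have hpot (c : X) : ∃ f : X → G, ∀ a : Dart X, a.edge ≤ c → f a.tgt = ρ a * f a.src := by
    obtain ⟨C⟩ := exists_chart c
    exact C.exists_potential hinv hsq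
  choose H hH using hpot
  choose z hz hzc using exists_vertex_le (X := X)
  -- Potentials on two nested cubes differ by right multiplication by a constant; these constants
  -- form a cocycle on the order complex.
  let g (c d : B) : G := if c ≤ d then (H c (z c))⁻¹ * H d (z c) else (H c (z d))⁻¹ * H d (z d)
  have hconst {c d e : X} (hc : e ≤ c) (hd : e ≤ d) {x y : X} (hx : IsMin x) (hy : IsMin y)
      (hxe : x ≤ e) (hye : y ≤ e) : (H c x)⁻¹ * H d x = (H c y)⁻¹ * H d y := by
    obtain ⟨E⟩ := exists_chart e
    refine E.eq_of_dart_eq (f := fun x => (H c x)⁻¹ * H d x) (fun a ha => ?_) hx hy hxe hye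
    simp [hH c a (ha.trans hc), hH d a (ha.trans hd), mul_assoc]
  have hg {c d : B} (h : c ≤ d ∨ d ≤ c) {x : X} (hx : IsMin x) (hxc : x ≤ c) (hxd : x ≤ d) :
      g c d = (H c x)⁻¹ * H d x := by
    by_cases hcd : c ≤ d
    · simp only [g, if_pos hcd]
      exact hconst le_rfl hcd (hz _) hx (hzc _) hxc
    · simp only [g, if_neg hcd]
      exact hconst (h.resolve_left hcd) le_rfl (hz _) hx (hzc _) hxd
  have hcomp {s : Finset B} (hs : s ∈ (orderComplex B).faces) {c d : B} (hc : c ∈ s)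
      (hd : d ∈ s) : c ≤ d ∨ d ≤ c := hs.2.total hc hd
  obtain ⟨k, hk⟩ := PreAbstractSimplicialComplex.exists_coboundary
    (K := (orderComplex B).toPreAbstractSimplicialComplex) g (by
      rintro c d e ⟨s, hs, hc, hd, he⟩
      have h1 := hcomp hs hc hd
      have h2 := hcomp hs hd he
      have h3 := hcomp hs hc he
      -- All three constants can be computed at a vertex of the smallest of the three cubes.
      obtain ⟨m, m1, m2, m3⟩ : ∃ m : X, m ≤ c ∧ m ≤ d ∧ m ≤ e := by
        rcases h1 with h1 | h1
        · rcases h3 with h3 | h3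
          · exact ⟨c, le_rfl, h1, h3⟩
          · exact ⟨e, h3, h3.trans h1, le_rfl⟩
        · rcases h2 with h2 | h2
          · exact ⟨d, h1, le_rfl, h2⟩
          · exact ⟨e, h2.trans h1, h2, le_rfl⟩
      have hm := hzc m
      rw [hg h1 (hz m) (hm.trans m1) (hm.trans m2), hg h2 (hz m) (hm.trans m2) (hm.trans m3),
        hg h3 (hz m) (hm.trans m1) (hm.trans m3)]
      group)
  -- Correcting each local potential by the coboundary makes the potentials on nested cubes agree at
  -- common vertices.
  refine ⟨fun x => if hx : x ∈ B then H x x * (k ⟨x, hx⟩)⁻¹ else 1, fun a ha => ?_⟩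
  have key {x : X} (hx : IsMin x) (hxa : x ≤ a.edge) :
      (if hx : x ∈ B then H x x * (k ⟨x, hx⟩)⁻¹ else 1) = H a.edge x * (k ⟨a.edge, ha⟩)⁻¹ := by
    have hxB : x ∈ B := hB hxa ha
    have hle : (⟨x, hxB⟩ : B) ≤ ⟨a.edge, ha⟩ := hxa
    have h1 := hk ⟨x, hxB⟩ ⟨a.edge, ha⟩ ⟨{⟨x, hxB⟩, ⟨a.edge, ha⟩}, ⟨by simp, by
      simpa using IsChain.pair (r := (· ≤ ·)) hle⟩, by simp, by simp⟩
    rw [hg (.inl hle) hx le_rfl hxa] at h1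
    rw [dif_pos hxB]
    have h2 : H a.edge x = H x x * ((k ⟨x, hxB⟩)⁻¹ * k ⟨a.edge, ha⟩) := by
      rw [← h1]; simp
    rw [h2]
    group
  beta_reduce
  rw [key a.isMin_tgt a.tgt_covBy.le, key a.isMin_src a.src_covBy.le, hH _ a le_rfl, mul_assoc]

/-! ### The smallest cube containing given vertices -/

namespace Chart

variable {d : X} (C : Chart d)

/-- Swaps stay inside the cube and preserve the set of directions allowed. Backtracking over the
last edge would need its direction to occur earlier, but the directions are distinct. -/
theorem reduced_word {k : ℕ} (hX : IsLocallyLarge X k) (p : Fin C.dim → Bool)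
    {l : List (Fin C.dim)} (hl : l.Nodup) : (squareSystem hX).Reduced (C.word p l) := by
  induction l with
  | nil => trivial
  | cons i l ih =>
    obtain ⟨hi, hl⟩ := List.nodup_cons.1 hl
    refine ⟨ih hl, fun q hq => ?_⟩
    have h := hq.forall_mem (C := fun a => ∃ r, ∃ j ∈ l, a = C.dart r j) ?_ ?_
    · obtain ⟨r, j, hj, e⟩ := h _ List.mem_cons_self
      have e' : C.dart (flip (C.flips p l) i) i = C.dart r j := (C.dart_inv _ _).symm.trans e
      exact hi ((C.dart_inj e').2 ▸ hj)
    · rintro a b a' b' hs ⟨r, j, hj, rfl⟩ ⟨r', j', hj', rfl⟩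
      have hs : Dart.Sq _ _ _ _ := hs
      have hle := hs.rot.le_of_le hX (C.le _ _) (C.le _ _)
      obtain ⟨z, m, n, -, h1, h2, rfl, rfl⟩ :=
        C.exists_of_sq hs (C.le _ _) (C.le _ _) hle.1 hle.2
      obtain ⟨-, rfl⟩ := C.dart_inj h1
      obtain ⟨-, rfl⟩ := C.dart_inj h2
      exact ⟨⟨_, _, hj', rfl⟩, ⟨_, _, hj, rfl⟩⟩
    · clear hq hi ih hl
      intro x hx
      suffices H : ∀ m : List (Fin C.dim), m ⊆ l → ∀ x ∈ C.word p m,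
          ∃ r, ∃ j ∈ l, x = C.dart r j from H l (fun _ h => h) x hx
      intro m hm
      induction m with
      | nil => simp [word]
      | cons i m ih =>
        intro x hx
        rcases List.mem_cons.1 hx with rfl | hx
        · exact ⟨_, i, hm List.mem_cons_self, rfl⟩
        · exact ih (fun _ h => hm (List.mem_cons_of_mem _ h)) x hx

end Chart

theorem isLowerSet_cubicalNeighborhood (k : ℕ) (v : Vertex X) :
    IsLowerSet (cubicalNeighborhood k v) :=
  fun _ _ hdc hc w hw => hc w (hw.trans hdc)

theorem mem_cubicalNeighborhood_two {v : Vertex X} {c : X} (h : v.1 ≤ c) :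
    c ∈ cubicalNeighborhood 2 v := by
  intro w hw
  rcases eq_or_ne v w with rfl | hvw
  · simp
  · rw [SimpleGraph.edist_eq_one_iff_adj.2
      (show (cubicalGraph X).Adj v w from ⟨hvw, c, h, hw⟩)]
    norm_num

/-- If two cubes share two vertices, then they share the edges at one of these vertices in the
directions in which the two vertices differ. -/
theorem edge_le_of_vertices_le (hX : IsFiveLarge X) {c d v w : X} (hv : IsMin v) (hw : IsMin w)
    (hvd : v ≤ d) (hwd : w ≤ d) (C : Chart c) {p r : Fin C.dim → Bool} (hp : v = C.vert p)
    (hr : w = C.vert r) {i : Fin C.dim} (hi : p i ≠ r i) : C.F p {i} ≤ d := by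
  obtain ⟨hloc, hcon⟩ := hX
  let Q := squareSystem hloc
  have := hcon ⟨v, hv⟩
  obtain ⟨f, hf⟩ := exists_potential (isLowerSet_cubicalNeighborhood 2 ⟨v, hv⟩) (ρ := Q.hol)
    (fun a => Q.hol_inv a) (fun a b a' b' h => SquareSystem.hol_square (Q := Q) h)
  have hfle {e : X} (he : v ≤ e) (a : Dart X) (ha : a.edge ≤ e) :
      f a.tgt = Q.hol a * f a.src :=
    hf a (isLowerSet_cubicalNeighborhood 2 ⟨v, hv⟩ ha (mem_cubicalNeighborhood_two he))
  obtain ⟨D⟩ := exists_chart d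
  obtain ⟨p', hp'⟩ := D.exists_vert_eq hv hvd
  obtain ⟨r', hr'⟩ := D.exists_vert_eq hw hwd
  obtain ⟨l', hl', -, e'⟩ := D.exists_flips_eq r' p'
  -- The path in `c` first reaches the neighbor of `v` in direction `i`, so that its last edge, the
  -- head of the word, is the edge in question.
  obtain ⟨l, hl, hmem, e⟩ := C.exists_flips_eq r (flip p i)
  have hil : i ∉ l := by
    rw [hmem, flip_self]
    revert hi
    cases p i <;> cases r i <;> simp
  have h1 := C.potential_word (hfle (hp ▸ C.le _ _)) r (i :: l)
  have h2 := D.potential_word (hfle hvd) r' l'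
  rw [Chart.flips, e, flip_flip, ← hp, ← hr] at h1
  rw [e', ← hp', ← hr', h1] at h2
  have hs := SquareSystem.swap_of_hol_eq (C.reduced_word hloc r (List.nodup_cons.2 ⟨hil, hl⟩))
    (D.reduced_word hloc r' hl') (mul_right_cancel h2)
  -- A cube that contains two consecutive sides of a square contains the other two, so the swaps
  -- starting from the path in `d` remain in `d`.
  have := hs.symm.forall_mem (C := fun a => a.edge ≤ d)
    (fun {a b a' b'} h ha hb => Dart.Sq.le_of_le hloc (Dart.Sq.rot h) ha hb)
    (D.word_edge_le r' l') _ List.mem_cons_self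
  have h3 : (C.dart (C.flips r l) i).edge = C.F p {i} := by
    rw [e, ← C.dart_inv]
    rfl
  exact h3 ▸ this

/-- A nonempty set of vertices that is contained in a cube is contained in a smallest cube. -/
theorem exists_isLeast_cube (hX : IsFiveLarge X) {S : Set X} (hS : S.Nonempty)
    (hmin : ∀ x ∈ S, IsMin x) (hc : ∃ c, ∀ x ∈ S, x ≤ c) :
    ∃ q, IsLeast {c : X | ∀ x ∈ S, x ≤ c} q := by
  classical
  obtain ⟨c, hc⟩ := hc
  obtain ⟨v, hvS⟩ := hS
  have hv := hmin v hvS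
  obtain ⟨C⟩ := exists_chart c
  obtain ⟨p, hp⟩ := C.exists_vert_eq hv (hc v hvS)
  -- The directions of `c` in which some vertex of `S` differs from `v`; they span the smallest
  -- cube.
  let s : Finset (Fin C.dim) := Finset.univ.filter fun i => ∃ r, C.vert r ∈ S ∧ p i ≠ r i
  refine ⟨C.F p s, fun x hx => ?_, fun d hd => ?_⟩
  · obtain ⟨r, rfl⟩ := C.exists_vert_eq (hmin x hx) (hc x hx)
    rw [C.vert_le_iff]
    intro i hi
    by_contra h
    exact hi (Finset.mem_filter.2 ⟨Finset.mem_univ _, r, hx, Ne.symm h⟩)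
  · have hedge : ∀ i ∈ s, C.F p {i} ≤ d := by
      intro i hi
      obtain ⟨-, r, hr, hne⟩ := Finset.mem_filter.1 hi
      exact edge_le_of_vertices_le hX hv (hmin _ hr) (hd v hvS) (hd _ hr) C hp rfl hne
    obtain ⟨D⟩ := exists_chart d
    obtain ⟨p', hp'⟩ := D.exists_vert_eq hv (hd v hvS)
    -- The same edges at `v` read in `d`. The faces they span in `c` and in `d` are equal because a
    -- cube at `v` is determined by its edges at `v`.
    let t : Finset (Fin D.dim) := Finset.univ.filter fun j => ∃ i ∈ s, C.F p {i} = D.F p' {j}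
    have : C.F p s = D.F p' t := by
      refine (hX.1 v hv).1 _ _ (hp ▸ C.vert_le _ _) (hp' ▸ D.vert_le _ _) fun e he => ?_
      rw [C.covBy_le_iff (hp ▸ he), D.covBy_le_iff (hp' ▸ he)]
      constructor
      · rintro ⟨i, hi, rfl⟩
        obtain ⟨j, hj⟩ := D.exists_of_covBy (hp' ▸ he) (hedge i hi)
        exact ⟨j, Finset.mem_filter.2 ⟨Finset.mem_univ _, i, hi, hj⟩, hj⟩
      · rintro ⟨j, hj, rfl⟩
        obtain ⟨-, i, hi, h⟩ := Finset.mem_filter.1 hj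
        exact ⟨i, hi, h.symm⟩
    rw [this]
    exact D.le _ _

end CubeComplex

/-! ### Homotopies between maps of realizations -/

namespace PreAbstractSimplicialComplex

variable {ι : Type u} {κ : Type v} {K : PreAbstractSimplicialComplex ι}
  {L : PreAbstractSimplicialComplex κ}

namespace Realization

/-- The set `s` need not be the face chosen in the definition of the point: both sums agree with the
sum over the union. -/
theorem sum_eq_one (x : K.Realization) {s : Finset ι} (hs : ∀ i, i ∉ s → x.1 i = 0) :
    ∑ i ∈ s, x.1 i = 1 := by
  classical
  obtain ⟨-, t, -, h1, h2⟩ := x.2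
  have e₁ := Finset.sum_subset (Finset.subset_union_left (s₂ := t)) fun i _ hi => hs i hi
  have e₂ := Finset.sum_subset (Finset.subset_union_right (s₁ := s)) fun i _ hi => h1 i hi
  exact e₁.trans (e₂.symm.trans h2)

/-- Two maps are homotopic if their values at each point lie in a common closed simplex. -/
theorem homotopic_of_common_face {A : Type*} [TopologicalSpace A] (f g : C(A, K.Realization))
    (h : ∀ a, ∃ s ∈ K.faces, (∀ i, i ∉ s → (f a).1 i = 0) ∧ ∀ i, i ∉ s → (g a).1 i = 0) :
    f.Homotopic g := by
  let H (p : unitInterval × A) : K.Realization :=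
    ⟨fun i => (1 - (p.1 : ℝ)) * (f p.2).1 i + p.1 * (g p.2).1 i, fun i =>
      add_nonneg (mul_nonneg (sub_nonneg.2 p.1.2.2) ((f p.2).2.1 i))
        (mul_nonneg p.1.2.1 ((g p.2).2.1 i)), by
      obtain ⟨s, hs, h1, h2⟩ := h p.2
      refine ⟨s, hs, fun i hi => by simp [h1 i hi, h2 i hi], ?_⟩
      rw [Finset.sum_add_distrib, ← Finset.mul_sum, ← Finset.mul_sum, sum_eq_one _ h1,
        sum_eq_one _ h2]
      ring⟩
  have hH : Continuous H := by
    refine continuous_mk fun i => ?_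
    have h1 : Continuous fun a => (f a).1 i := (continuous_apply i).comp f.continuous
    have h2 : Continuous fun a => (g a).1 i := (continuous_apply i).comp g.continuous
    simp only [H]
    fun_prop
  exact ⟨⟨⟨H, hH⟩, fun a => Subtype.ext (by simp [H]), fun a => Subtype.ext (by simp [H])⟩⟩

/-- The map of realizations induced by a simplicial map between finite complexes. -/
noncomputable def map [Fintype ι] [DecidableEq κ] (φ : ι → κ)
    (hφ : ∀ s ∈ K.faces, ∃ t ∈ L.faces, ∀ i ∈ s, φ i ∈ t) : C(K.Realization, L.Realization) where
  toFun x := ⟨fun j => ∑ i with φ i = j, x.1 i, fun j => Finset.sum_nonneg fun i _ => x.2.1 i, by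
    obtain ⟨-, s, hs, h1, h2⟩ := x.2
    obtain ⟨t, ht, hst⟩ := hφ s hs
    have hx : ∀ i, φ i ∉ t → x.1 i = 0 := fun i hi => h1 i fun h => hi (hst i h)
    refine ⟨t, ht, fun j hj => Finset.sum_eq_zero fun i hi => hx i ?_, ?_⟩
    · rwa [(Finset.mem_filter.1 hi).2]
    · exact (Finset.sum_fiberwise_eq_sum_filter _ t φ x.1).trans
        (sum_eq_one x fun i hi => hx i fun h => hi (Finset.mem_filter.2 ⟨Finset.mem_univ i, h⟩))⟩
  continuous_toFun := continuous_mk fun j =>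
    continuous_finsetSum _ fun i _ => continuous_apply i

theorem map_eq_zero [Fintype ι] [DecidableEq κ] {φ : ι → κ}
    {hφ : ∀ s ∈ K.faces, ∃ t ∈ L.faces, ∀ i ∈ s, φ i ∈ t} {x : K.Realization} {s : Finset ι}
    {t : Finset κ} (hx : ∀ i, i ∉ s → x.1 i = 0) (hst : ∀ i ∈ s, φ i ∈ t) (j : κ) (hj : j ∉ t) :
    (map φ hφ x).1 j = 0 :=
  Finset.sum_eq_zero fun i hi => hx i fun h => hj ((Finset.mem_filter.1 hi).2 ▸ hst i h)

/-- Two finite complexes are homotopy equivalent if there are vertex maps in both directions and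
the faces of both complexes lie in pairs of faces exchanged by these maps. -/
theorem nonempty_homotopyEquiv [Finite ι] [Finite κ] (φ : ι → κ) (ψ : κ → ι)
    (hK : ∀ s ∈ K.faces, ∃ s' ∈ K.faces, ∃ t' ∈ L.faces,
      s ⊆ s' ∧ (∀ i ∈ s', φ i ∈ t') ∧ ∀ j ∈ t', ψ j ∈ s')
    (hL : ∀ t ∈ L.faces, ∃ s' ∈ K.faces, ∃ t' ∈ L.faces,
      t ⊆ t' ∧ (∀ i ∈ s', φ i ∈ t') ∧ ∀ j ∈ t', ψ j ∈ s') :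
    Nonempty (K.Realization ≃ₕ L.Realization) := by
  classical
  have := Fintype.ofFinite ι
  have := Fintype.ofFinite κ
  have hφ : ∀ s ∈ K.faces, ∃ t ∈ L.faces, ∀ i ∈ s, φ i ∈ t := fun s hs => by
    obtain ⟨s', -, t', ht', h, h1, -⟩ := hK s hs
    exact ⟨t', ht', fun i hi => h1 i (h hi)⟩
  have hψ : ∀ t ∈ L.faces, ∃ s ∈ K.faces, ∀ j ∈ t, ψ j ∈ s := fun t ht => by
    obtain ⟨s', hs', t', -, h, -, h1⟩ := hL t ht
    exact ⟨s', hs', fun i hi => h1 i (h hi)⟩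
  refine ⟨⟨map φ hφ, map ψ hψ, ?_, ?_⟩⟩ <;> refine homotopic_of_common_face _ _ fun x => ?_ <;>
    obtain ⟨-, s, hs, h0, -⟩ := x.2
  · obtain ⟨s', hs', t', ht', h, h1, h2⟩ := hK s hs
    have hx : ∀ i, i ∉ s' → x.1 i = 0 := fun i hi => h0 i fun hi' => hi (h hi')
    exact ⟨s', hs', map_eq_zero (hφ := hψ) (map_eq_zero (hφ := hφ) hx h1) h2, hx⟩
  · obtain ⟨s', hs', t', ht', h, h1, h2⟩ := hL s hs
    have hx : ∀ i, i ∉ t' → x.1 i = 0 := fun i hi => h0 i fun hi' => hi (h hi')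
    exact ⟨t', ht', map_eq_zero (hφ := hφ) (map_eq_zero (hφ := hψ) hx h2) h1, hx⟩

end Realization

theorem IsSimplex.contractibleSpace (hK : K.IsSimplex) : ContractibleSpace K.Realization := by
  classical
  obtain ⟨s, ⟨i, hi⟩, h⟩ := hK
  have hs : s ∈ K.faces := (h s).2 ⟨⟨i, hi⟩, subset_rfl⟩
  rw [contractible_iff_id_nullhomotopic]
  refine ⟨Realization.edgePoint hs hi hi 0, Realization.homotopic_of_common_face _ _ fun x => ?_⟩
  obtain ⟨-, t, ht, h0, -⟩ := x.2
  refine ⟨s, hs, fun j hj => h0 j fun hjt => hj (((h t).1 ht).2 hjt), fun j hj => ?_⟩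
  have hji : j ≠ i := fun e => hj (e ▸ hi)
  change (Realization.edgePoint hs hi hi 0).1 j = 0
  simp only [Realization.edgePoint, if_neg hji, add_zero]

theorem isEmpty_realization (hK : ∀ s, s ∉ K.faces) : IsEmpty K.Realization :=
  ⟨fun x => let ⟨_, s, hs, _⟩ := x.2; hK s hs⟩

end PreAbstractSimplicialComplex

/-! ### The link of a simplex of the thickening -/

namespace CubeComplex

variable {X : Type u} [CubeComplex X]

/-- If the face `q` missed a direction of `e`, flipping that coordinate would give a vertex of `e`
outside `q`. This is what provides a vertex in each cover of `q` outside `q`. -/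
theorem le_of_forall_vertex_le {q e : X} (hqe : q ≤ e) (h : ∀ z, IsMin z → z ≤ e → z ≤ q) :
    e ≤ q := by
  obtain ⟨C⟩ := exists_chart e
  obtain ⟨p, s, he⟩ := C.exists_eq le_rfl
  obtain ⟨r, t, rfl⟩ := C.exists_eq hqe
  have h' (p' : Fin C.dim → Bool) : ∀ i, i ∉ t → p' i = r i :=
    C.vert_le_iff.1 (h _ (C.isMin_vert _) (C.le _ _))
  refine he.le.trans (C.le_iff.2 ⟨fun i _ => by_contra fun hi => ?_, h' p⟩)
  have h1 := h' (flip p i) i hi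
  rw [flip_self, h' p i hi] at h1
  simp at h1

variable {Y : Type v} (α : Y → Vertex X)

/-- The subcomplex of the thickening spanned by the vertices outside `σ` that `α` maps into the
cube `q`. -/
def innerLink (q : X) (σ : Finset Y) : PreAbstractSimplicialComplex Y where
  faces := {τ | τ.Nonempty ∧ Disjoint σ τ ∧ ∀ y ∈ τ, (α y).1 ≤ q}
  isRelLowerSet_faces := fun _ ⟨hne, hd, h⟩ =>
    ⟨hne, fun _ ht htne => ⟨htne, hd.mono_right ht, fun y hy => h y (ht hy)⟩⟩

/-- The subcomplex of the thickening whose faces are mapped by `α` outside the cube `q` but into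
a cube that contains `q`. -/
def outerLink (q : X) : PreAbstractSimplicialComplex Y where
  faces := {τ | τ.Nonempty ∧ (∀ y ∈ τ, ¬ (α y).1 ≤ q) ∧ ∃ d, q ≤ d ∧ ∀ y ∈ τ, (α y).1 ≤ d}
  isRelLowerSet_faces := fun _ ⟨hne, h, d, hqd, hd⟩ =>
    ⟨hne, fun _ ht htne => ⟨htne, fun y hy => h y (ht hy), d, hqd, fun y hy => hd y (ht hy)⟩⟩

variable {α}

theorem isJoin_link [DecidableEq Y] {σ : Finset Y} {q : X}
    (hq : IsLeast {c : X | ∀ y ∈ σ, (α y).1 ≤ c} q) :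
    ((thickening α).toPreAbstractSimplicialComplex.link σ).IsJoin
      (innerLink α q σ) (outerLink α q) := by
  classical
  have hout {τ : Finset Y} (h : τ ∈ (outerLink α q).faces) : Disjoint σ τ :=
    Finset.disjoint_left.2 fun y hy hy' => h.2.1 y hy' (hq.1 y hy)
  refine ⟨fun s hs t ht => Finset.disjoint_left.2 fun y hy hy' => ht.2.1 y hy' (hs.2.2 y hy),
    fun r => ⟨?_, ?_⟩⟩
  · rintro ⟨hne, hd, -, d, hd'⟩
    -- Minimality of `q` puts the cube of any simplex containing `σ` above `q`; inner vertices can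
    -- therefore be added to an outer face without changing its cube.
    have hqd : q ≤ d := hq.2 fun y hy => hd' y (Finset.mem_union_left _ hy)
    have hrd : ∀ y ∈ r, (α y).1 ≤ d := fun y hy => hd' y (Finset.mem_union_right _ hy)
    have h1 (h : (r.filter fun y => (α y).1 ≤ q).Nonempty) :
        (r.filter fun y => (α y).1 ≤ q) ∈ (innerLink α q σ).faces :=
      ⟨h, hd.mono_right (Finset.filter_subset _ _), fun y hy => (Finset.mem_filter.1 hy).2⟩
    have h2 (h : (r.filter fun y => ¬ (α y).1 ≤ q).Nonempty) :
        (r.filter fun y => ¬ (α y).1 ≤ q) ∈ (outerLink α q).faces :=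
      ⟨h, fun y hy => (Finset.mem_filter.1 hy).2, d, hqd,
        fun y hy => hrd y (Finset.mem_filter.1 hy).1⟩
    have h3 := Finset.filter_union_filter_not_eq (fun y => (α y).1 ≤ q) r
    rcases (r.filter fun y => (α y).1 ≤ q).eq_empty_or_nonempty with e1 | e1
    · rw [e1, Finset.empty_union] at h3
      exact .inr (.inl (h3 ▸ h2 (h3.symm ▸ hne)))
    rcases (r.filter fun y => ¬ (α y).1 ≤ q).eq_empty_or_nonempty with e2 | e2
    · rw [e2, Finset.union_empty] at h3
      exact .inl (h3 ▸ h1 (h3.symm ▸ hne))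
    · exact .inr (.inr ⟨_, h1 e1, _, h2 e2, h3.symm⟩)
  · rintro (h | h | ⟨s, hs, t, ht, rfl⟩)
    · refine ⟨h.1, h.2.1, h.1.mono Finset.subset_union_right, q, fun y hy => ?_⟩
      exact (Finset.mem_union.1 hy).elim (hq.1 y) (h.2.2 y)
    · obtain ⟨d, hqd, hd⟩ := h.2.2
      refine ⟨h.1, hout h, h.1.mono Finset.subset_union_right, d, fun y hy => ?_⟩
      exact (Finset.mem_union.1 hy).elim (fun hy => (hq.1 y hy).trans hqd) (hd y)
    · obtain ⟨d, hqd, hd⟩ := ht.2.2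
      refine ⟨hs.1.mono Finset.subset_union_left, Finset.disjoint_union_right.2 ⟨hs.2.1, hout ht⟩,
        (hs.1.mono Finset.subset_union_left).mono Finset.subset_union_right, d, fun y hy => ?_⟩
      simp only [Finset.mem_union] at hy
      rcases hy with hy | hy | hy
      · exact (hq.1 y hy).trans hqd
      · exact (hs.2.2 y hy).trans hqd
      · exact hd y hy

theorem innerLink_eq_bot_or_isSimplex [Finite Y] (q : X) (σ : Finset Y) :
    innerLink α q σ = ⊥ ∨ (innerLink α q σ).IsSimplex := by
  classical
  have := Fintype.ofFinite Y
  let s : Finset Y := Finset.univ.filter fun y => y ∉ σ ∧ (α y).1 ≤ q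
  have hs (t : Finset Y) : t ∈ (innerLink α q σ).faces ↔ t.Nonempty ∧ t ⊆ s := by
    refine and_congr_right fun _ => ?_
    simp only [s, Finset.disjoint_right, Finset.subset_iff, Finset.mem_filter, Finset.mem_univ,
      true_and]
    exact ⟨fun h y hy => ⟨h.1 hy, h.2 y hy⟩, fun h => ⟨fun y hy => (h hy).1, fun y hy => (h hy).2⟩⟩
  rcases s.eq_empty_or_nonempty with h | h
  · left
    ext t
    rw [hs, h, Finset.subset_empty]
    exact ⟨fun ⟨h1, h2⟩ => (h1.ne_empty h2).elim, fun h => h.elim⟩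
  · exact .inr ⟨s, h, hs⟩

/-- The part of the link of a simplex of the thickening away from its smallest cube `q` is
homotopy equivalent to the link of `q`. -/
theorem nonempty_outerLink_homotopyEquiv [Finite X] [Finite Y]
    (hX : IsFiveLarge X) (hα : Function.Surjective α) {σ : Finset Y} {q : X}
    (hq : IsLeast {c : X | ∀ y ∈ σ, (α y).1 ≤ c} q) :
    Nonempty ((outerLink α q).Realization ≃ₕ
      (link q).toPreAbstractSimplicialComplex.Realization) := by
  classical
  have := Fintype.ofFinite X
  have := Fintype.ofFinite Y
  have hout (y : Y) (hy : ¬ (α y).1 ≤ q) (h : ∃ d, q ≤ d ∧ (α y).1 ≤ d) :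
      ∃ e : {c : X // q ⋖ c}, ∀ d, q ≤ d → (α y).1 ≤ d → e.1 ≤ d := by
    obtain ⟨d, hqd, hd⟩ := h
    -- The smallest cube containing `α y` and the image of `σ` lies strictly above `q`; any cover of
    -- `q` below it lies in every cube above `q` that contains `α y`.
    obtain ⟨c, hc, hmin⟩ := exists_isLeast_cube hX
      (S := {x | x = (α y).1 ∨ ∃ z ∈ σ, x = (α z).1}) ⟨_, .inl rfl⟩
      (by rintro _ (rfl | ⟨z, -, rfl⟩) <;> exact (α _).2)
      ⟨d, by
        rintro _ (rfl | ⟨z, hz, rfl⟩)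
        · exact hd
        · exact (hq.1 z hz).trans hqd⟩
    have hqc : q ≤ c := hq.2 fun z hz => hc _ (.inr ⟨z, hz, rfl⟩)
    have hlt : q < c := hqc.lt_of_ne fun e => hy (e ▸ hc _ (.inl rfl))
    obtain ⟨e, he, hec⟩ := exists_covBy_le_of_lt hlt
    refine ⟨⟨e, he⟩, fun d hqd hd => hec.trans (hmin ?_)⟩
    rintro _ (rfl | ⟨z, hz, rfl⟩)
    · exact hd
    · exact (hq.1 z hz).trans hqd
  have hin (e : {c : X // q ⋖ c}) : ∃ y, ¬ (α y).1 ≤ q ∧ (α y).1 ≤ e.1 := by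
    by_contra! h
    refine e.2.lt.not_ge (le_of_forall_vertex_le e.2.le fun z hz hze => ?_)
    obtain ⟨y, hy⟩ := hα ⟨z, hz⟩
    by_contra hzq
    exact h y (by rwa [hy]) (by rwa [hy])
  rcases isEmpty_or_nonempty {c : X // q ⋖ c} with hE | hE
  · have h1 : IsEmpty (outerLink α q).Realization :=
      PreAbstractSimplicialComplex.isEmpty_realization fun s ⟨⟨y, hy⟩, h1, d, hqd, hd⟩ =>
        hE.elim (hout y (h1 y hy) ⟨d, hqd, hd y hy⟩).choose
    have h2 : IsEmpty (link q).toPreAbstractSimplicialComplex.Realization :=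
      PreAbstractSimplicialComplex.isEmpty_realization fun s ⟨⟨e, _⟩, _⟩ => hE.elim e
    exact ⟨(Homeomorph.empty).toHomotopyEquiv⟩
  -- Once a link vertex exists, the map can be made total with arbitrary values away from the
  -- vertices of the outer link.
  · have hout' (y : Y) : ∃ e : {c : X // q ⋖ c}, ¬ (α y).1 ≤ q →
        ∀ d, q ≤ d → (α y).1 ≤ d → e.1 ≤ d := by
      by_cases h : ¬ (α y).1 ≤ q ∧ ∃ d, q ≤ d ∧ (α y).1 ≤ d
      · exact (hout y h.1 h.2).imp fun e he _ => he
      · exact ⟨Classical.arbitrary _, fun hy d hqd hd => absurd ⟨hy, d, hqd, hd⟩ h⟩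
    choose φ hφ using hout'
    choose ψ hψ hψ' using hin
    -- For a cube `d` above `q`, these are the largest faces of the two complexes carried by `d`;
    -- `φ` and `ψ` exchange them.
    let A (d : X) : Finset Y := Finset.univ.filter fun y => ¬ (α y).1 ≤ q ∧ (α y).1 ≤ d
    let B (d : X) : Finset {c : X // q ⋖ c} := Finset.univ.filter fun e => e.1 ≤ d
    have hA (d : X) (hd : q ≤ d) (h : (A d).Nonempty) : A d ∈ (outerLink α q).faces :=
      ⟨h, fun y hy => (Finset.mem_filter.1 hy).2.1, d, hd, fun y hy => (Finset.mem_filter.1 hy).2.2⟩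
    have hB (d : X) (h : (B d).Nonempty) : B d ∈ (link q).faces :=
      ⟨h, d, fun e he => (Finset.mem_filter.1 he).2⟩
    have hAB (d : X) (hd : q ≤ d) : ∀ y ∈ A d, φ y ∈ B d := fun y hy => by
      obtain ⟨-, h1, h2⟩ := Finset.mem_filter.1 hy
      exact Finset.mem_filter.2 ⟨Finset.mem_univ _, hφ y h1 d hd h2⟩
    have hBA (d : X) : ∀ e ∈ B d, ψ e ∈ A d := fun e he =>
      Finset.mem_filter.2 ⟨Finset.mem_univ _, hψ e, (hψ' e).trans (Finset.mem_filter.1 he).2⟩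
    refine PreAbstractSimplicialComplex.Realization.nonempty_homotopyEquiv φ ψ ?_ ?_
    · rintro s ⟨⟨y, hy⟩, h, d, hqd, hd⟩
      have hs : s ⊆ A d := fun y hy =>
        Finset.mem_filter.2 ⟨Finset.mem_univ _, h y hy, hd y hy⟩
      exact ⟨A d, hA d hqd ⟨y, hs hy⟩, B d, hB d ⟨_, hAB d hqd y (hs hy)⟩, hs, hAB d hqd, hBA d⟩
    · rintro t ⟨⟨e, he⟩, d, hd⟩
      have ht : t ⊆ B d := fun e he => Finset.mem_filter.2 ⟨Finset.mem_univ _, hd e he⟩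
      have hqd : q ≤ d := e.2.le.trans (hd e he)
      exact ⟨A d, hA d hqd ⟨_, hBA d e (ht he)⟩, B d, hB d ⟨e, ht he⟩, ht, hAB d hqd, hBA d⟩

end CubeComplex

theorem mainTheorem8 {X : Type u} [CubeComplex X] [Finite X] (hX : CubeComplex.IsFiveLarge X)
    {Y : Type v} [Finite Y] [DecidableEq Y] (α : Y → CubeComplex.Vertex X)
    (hα : Function.Surjective α) (σ : Finset Y) (hσ : σ ∈ (CubeComplex.thickening α).faces) :
    ∃ q : X, IsLeast {c : X | ∀ y ∈ σ, (α y).1 ≤ c} q ∧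
      ∃ L' L'' : PreAbstractSimplicialComplex Y,
        ((CubeComplex.thickening α).toPreAbstractSimplicialComplex.link σ).IsJoin L' L'' ∧
        (L' = ⊥ ∨ L'.IsSimplex) ∧
        (L' ≠ ⊥ → ContractibleSpace L'.Realization) ∧
        Nonempty (L''.Realization ≃ₕ
          (CubeComplex.link q).toPreAbstractSimplicialComplex.Realization) := by
  obtain ⟨⟨y, hy⟩, c, hc⟩ := hσ
  obtain ⟨q, hq⟩ := CubeComplex.exists_isLeast_cube hX (S := {x | ∃ y ∈ σ, (α y).1 = x})
    ⟨_, y, hy, rfl⟩ (by rintro _ ⟨z, -, rfl⟩; exact (α z).2)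
    ⟨c, by rintro _ ⟨z, hz, rfl⟩; exact hc z hz⟩
  have hq' : IsLeast {c : X | ∀ y ∈ σ, (α y).1 ≤ c} q := by
    simpa only [Set.mem_ofPred_eq, forall_exists_index, and_imp, forall_apply_eq_imp_iff₂] using hq
  have h := CubeComplex.innerLink_eq_bot_or_isSimplex (α := α) q σ
  exact ⟨q, hq', CubeComplex.innerLink α q σ, CubeComplex.outerLink α q,
    CubeComplex.isJoin_link hq', h, fun hne => (h.resolve_left hne).contractibleSpace,
    CubeComplex.nonempty_outerLink_homotopyEquiv hX hα hq'⟩
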